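/- **Setting.** Consider a system $\mathbf{x}_{t+1}=f(\mathbf{x}_t,\mathbf{u}_t,\omega_t)$ with compact state space $\mathcal X\subseteq\mathbb R^n$, Borel action space $\mathcal U\subseteq\mathbb R^m$, Borel disturbance space $\mathcal W\subseteq\mathbb R^r$, continuous $f:\mathcal X\times\mathcal U\times\mathcal W\to\mathcal X$, and disturbances $\omega_t$ drawn independently from a probability distribution $d$ on $\mathcal W$. Let $\mathcal X_0\subseteq\mathcal X$ be a Borel set of initial states. Edge policies are continuous maps $\mathcal X\to\mathcal U$; a global policy may have memory. A trajectory is a sequence $(\mathbf x_t,\mathbf u_t,\omega_t)_{t\ge 0}$ that follows the dynamics with $\omega_t\in\mathrm{support}(d)$. **SpectRL.** Formulas are $\phi::=\mathrm{achieve}\ b\mid\phi\ \mathrm{ensuring}\ b\mid\phi;\phi\mid\phi\ \mathrm{or}\ \phi$, with $b$ a Boolean combination of Borel atomic predicates on $\mathcal X$. On a finite piece $\mathbf x_a,\dots,\mathbf x_c$: $\mathrm{achieve}\ b$ holds if some $\mathbf x_t$ in it satisfies $b$; $\phi\ \mathrm{ensuring}\ b$ holds if $\phi$ holds and all its states satisfy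 $b$; $\phi;\psi$ holds if for some $t\in[a,c]$, $\phi$ holds on $\mathbf x_a,\dots,\mathbf x_t$ and $\psi$ on $\mathbf x_t,\dots,\mathbf x_c$; $\phi\ \mathrm{or}\ \psi$ holds if one of the two does. A trajectory $\rho$ satisfies $\phi$ ($\rho\models\phi$) if some prefix of it does. A policy *guarantees* $(\phi,p)$ if for every $\mathbf x_0\in\mathcal X_0$ the event $\rho\models\phi$ is measurable and $\mathbb P_{\mathbf x_0}[\rho\models\phi]\ge p$. **Abstract graphs.** An abstract graph $G=(V,E,\beta,s,t)$ is a finite DAG with source $s$, target $t$, and Borel sets $\beta(v),\beta(e)\subseteq\mathcal X$ for vertices $v$ and edges $e$, with $\beta(s)=\mathcal X_0$. A trajectory satisfies $\rho\models G$ if there are a path $s=v_0,\dots,v_k=t$ and times $0=i_0\le\dots\le i_k$ with $\mathbf x_{i_j}\in\beta(v_j)$ for all $j$, and $\mathbf x_\tau\in\beta(v_j,v_{j+1})$ whenever $j<k$ and $i_j\le\tau\le i_{j+1}$. We say that $G$ is *an abstract graph for $\phi$* if $\rho\models G$ implies $\rho\models\phi$ for each trajectory from $\mathcal X_0$. The *translation*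 of $\phi$ is built bottom-up: $\mathrm{achieve}\ b$ gives one edge, labelled $\mathcal X$, from the source to a final vertex labelled $\{b\}$; $\mathrm{ensuring}\ b$ intersects all edge labels with $\{b\}$; for $\phi_1;\phi_2$ the final vertices of $\phi_1$, with their own labels, take the place of the source of $\phi_2$; for $\phi_1\ \mathrm{or}\ \phi_2$ one new source replaces the two sources, and the final vertices of both remain final. At the end the source is labelled $\mathcal X_0$; a unique final vertex is the target $t$, and several final vertices are joined to a new target $t$ by edges, with $t$ and these edges labelled $\mathcal X$. **Edge tasks.** The task of edge $(u,v)$ is to reach $\beta(v)$ from $\beta(u)$ while staying in $\beta(u,v)$. A certificate for it with parameter $q$ is a continuous policy $\pi:\mathcal X\to\mathcal U$ together with $\gamma\in(0,1)$, $\delta>0$, $\lambda>1$, $L,\Delta>0$ and a continuous $V:\mathcal X\to[0,\infty)$ such that $V\ge\delta$ outside $\beta(v)$, $V\le1$ on $\beta(u)$, $V\ge\lambda$ outside $\beta(u,v)$, $\mathbb E_{\omega\sim d}[V(f(\mathbf x,\pi(\mathbf x),\omega))]\le\gamma V(\mathbf x)$ whenever $\mathbf x\notin\beta(v)$ and $V(\mathbf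 x)\le\lambda$; $V$ is $L$-Lipschitz in $\|\cdot\|_1$; $\|\mathbf x-f(\mathbf x,\pi(\mathbf x),\omega)\|_1\le\Delta$ for all $\mathbf x,\omega$; and $q\le1-\frac1\lambda\gamma^{N}$ with $N=\lfloor(\lambda-1)/(L\Delta)\rfloor$. The subprocedure Policy+RASM is any procedure that, given an edge and $q$, either fails or returns such a certificate. **Algorithm (CLAPS).** Input: the system, $\mathcal X_0$, $\phi$, $p\in[0,1]$. Take an abstract graph $G$ for $\phi$ and a topological ordering $s=v_1,\dots,v_{|V|}=t$ of its vertices. Set $\mathrm{Prob}[s]=1$. For $i=2,\dots,|V|$: set $\mathrm{Prob}[v_i]=0$ and $N(v_i)=\{u:(u,v_i)\in E,\ \mathrm{Prob}[u]\ge p\}$; for each $u\in N(v_i)$, binary search on $[0,1]$ with a fixed number of steps for the largest $q$ at which Policy+RASM succeeds on $(u,v_i)$, and, if some call succeeded, keep the policy $\pi_{(u,v_i)}$ and parameter $p_{(u,v_i)}$ of the last successful call and set $\mathrm{Prob}[v_i]=\max\{\mathrm{Prob}[v_i],\,p_{(u,v_i)}\cdot\mathrm{Prob}[u]\}$. If $\mathrm{Prob}[t]\ge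 p$, choose a path from $s$ to $t$, with at least one edge, of edges $(u,v)$ with a learned policy, $u\in N(v)$ and $\mathrm{Prob}[v]=p_{(u,v)}\cdot\mathrm{Prob}[u]$, and output the global policy composed along it: follow the policy of the current edge until its target region is reached, then pass, at the same state, to the next edge of the path; if the safety region of the current edge is left at or before the time at which its target region is reached, keep the current edge policy forever; keep the last edge policy once $\beta(t)$ is reached. **Theorem (correctness of CLAPS).** Let $\phi$ be a SpectRL formula and $p\in[0,1]$. 1. The translation of $\phi$ is an abstract graph for $\phi$. 2. Let $G$ be any abstract graph for $\phi$, and consider a run of the algorithm on $G$, with any topological ordering from $s$ to $t$, any Policy+RASM subprocedure and any number of binary search steps. If the algorithm outputs a policy $\pi$, then $\pi$ guarantees $(\phi,p)$, and $\pi$ is compositional: it is the composition, along a path of $G$ from $s$ to $t$, of edge policies that Policy+RASM returned for the reach-avoid tasks of the edges. Moreover, if $p>0$, $s\ne t$ and $\mathrm{Prob}[t]\ge p$ after the forward pass, then a path as above exists, so that the algorithm does output a policy. -/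

import Mathlib

open MeasureTheory Set
open scoped Classical

noncomputable section

namespace Claps

/-! ### SpectRL: syntax and semantics -/

/-- Predicates over states: boolean combinations of (Borel) atomic predicates. -/
inductive Predicate (S : Type) [MeasurableSpace S] : Type
  | atom (a : S → Bool) (ha : Measurable a) : Predicate S
  | neg (b : Predicate S) : Predicate S
  | conj (b c : Predicate S) : Predicate S
  | disj (b c : Predicate S) : Predicate S

/-- The set of states that satisfy a predicate. -/
def Predicate.holds {S : Type} [MeasurableSpace S] : Predicate S → Set S
  | .atom a _ => {x | a x = true}
  | .neg b => (b.holds)ᶜ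
  | .conj b c => b.holds ∩ c.holds
  | .disj b c => b.holds ∪ c.holds

theorem Predicate.measurableSet_holds {S : Type} [MeasurableSpace S] (b : Predicate S) :
    MeasurableSet b.holds := by
  induction b with
  | atom a ha => exact ha (measurableSet_singleton true)
  | neg b ih => exact ih.compl
  | conj b c ihb ihc => exact ihb.inter ihc
  | disj b c ihb ihc => exact ihb.union ihc

/-- SpectRL formulas: `achieve b`, `φ ensuring b`, `φ ; ψ`, `φ or ψ`. -/
inductive SpectRL (S : Type) [MeasurableSpace S] : Type
  | achieve (b : Predicate S) : SpectRL S
  | ensuring (φ : SpectRL S) (b : Predicate S) : SpectRL S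
  | seq (φ ψ : SpectRL S) : SpectRL S
  | or (φ ψ : SpectRL S) : SpectRL S

/-- `φ.SatOn x a b`: the finite piece `x a, x (a+1), …, x b` satisfies `φ`. -/
def SpectRL.SatOn {S : Type} [MeasurableSpace S] :
    SpectRL S → (ℕ → S) → ℕ → ℕ → Prop
  | .achieve p, x, a, b => ∃ t, a ≤ t ∧ t ≤ b ∧ x t ∈ p.holds
  | .ensuring φ p, x, a, b => φ.SatOn x a b ∧ ∀ t, a ≤ t → t ≤ b → x t ∈ p.holds
  | .seq φ ψ, x, a, b => ∃ t, a ≤ t ∧ t ≤ b ∧ φ.SatOn x a t ∧ ψ.SatOn x t b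
  | .or φ ψ, x, a, b => φ.SatOn x a b ∨ ψ.SatOn x a b

/-- An infinite state sequence satisfies `φ` if some finite prefix of it does. -/
def SpectRL.Sat {S : Type} [MeasurableSpace S] (φ : SpectRL S) (x : ℕ → S) : Prop :=
  ∃ K, φ.SatOn x 0 K

/-! ### Abstract graphs -/

/-- An abstract graph: a finite DAG whose vertices and edges are labelled by Borel regions of
the state space, with a source labelled by the set `X₀` of initial states, and a target.
`region` and `safe` are the labels of vertices and of edges. -/
structure AbstractGraph (S : Type) [MeasurableSpace S] (X₀ : Set S) : Type 1 where
  V : Type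
  finite : Finite V
  Edge : V → V → Prop
  acyclic : ∀ v, ¬ Relation.TransGen Edge v v
  region : V → Set S
  safe : V → V → Set S
  measurableSet_region : ∀ v, MeasurableSet (region v)
  measurableSet_safe : ∀ u v, MeasurableSet (safe u v)
  source : V
  target : V
  region_source : region source = X₀

/-- Abstract reachability: there are a path `v 0, …, v k` from source to target and times
`0 = i 0 ≤ … ≤ i k` such that the sequence is in the region of `v j` at time `i j`, and satisfies
the safety label of the edge `(v j, v (j+1))` from time `i j` to time `i (j+1)`. -/
def AbstractGraph.Reachability {S : Type} [MeasurableSpace S] {X₀ : Set S}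
    (G : AbstractGraph S X₀) (x : ℕ → S) : Prop :=
  ∃ (k : ℕ) (i : ℕ → ℕ) (v : ℕ → G.V),
    i 0 = 0 ∧ v 0 = G.source ∧ v k = G.target ∧
    (∀ j < k, i j ≤ i (j + 1) ∧ G.Edge (v j) (v (j + 1))) ∧
    (∀ j ≤ k, x (i j) ∈ G.region (v j)) ∧
    (∀ j < k, ∀ t, i j ≤ t → t ≤ i (j + 1) → x t ∈ G.safe (v j) (v (j + 1)))

/-! ### Translation of SpectRL formulas into abstract graphs -/

theorem acyclic_of_rank {V : Type} {E : V → V → Prop} (r : V → ℕ)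
    (h : ∀ u v, E u v → r u < r v) (v : V) : ¬ Relation.TransGen E v v := by
  intro hv
  have key : ∀ w, Relation.TransGen E v w → r v < r w := by
    intro w hw
    induction hw with
    | single e => exact h _ _ e
    | tail _ e ih => exact ih.trans (h _ _ e)
  exact lt_irrefl _ (key v hv)

/-- A DAG under construction. `I` is the set of vertices other than the source; the source is
`none : Option I`, so no edge enters it. The vertices in `final` are those at which the formula
translated so far has been satisfied. `rank < height` witnesses finite depth (acyclicity). -/
structure OpenGraph (S : Type) [MeasurableSpace S] : Type 1 where
  I : Type
  finite : Finite I
  Edge : Option I → I → Prop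
  region : I → Set S
  safe : Option I → I → Set S
  final : Set I
  measurableSet_region : ∀ v, MeasurableSet (region v)
  measurableSet_safe : ∀ u v, MeasurableSet (safe u v)
  rank : I → ℕ
  height : ℕ
  rank_lt : ∀ v, rank v < height
  rank_mono : ∀ u v, Edge (some u) v → rank u < rank v

namespace OpenGraph

variable {S : Type} [MeasurableSpace S]

/-- One edge, from the source to a final vertex with region `b`, with no safety constraint. -/
def achieve (b : Predicate S) : OpenGraph S where
  I := Unit
  finite := inferInstance
  Edge u _ := u = none
  region _ := b.holds
  safe _ _ := univ
  final := univ
  measurableSet_region _ := b.measurableSet_holds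
  measurableSet_safe _ _ := MeasurableSet.univ
  rank _ := 0
  height := 1
  rank_lt _ := Nat.zero_lt_one
  rank_mono _ _ h := nomatch h

/-- Intersect the safety label of every edge with `b`. -/
def ensuring (G : OpenGraph S) (b : Predicate S) : OpenGraph S where
  I := G.I
  finite := G.finite
  Edge := G.Edge
  region := G.region
  safe u v := G.safe u v ∩ b.holds
  final := G.final
  measurableSet_region := G.measurableSet_region
  measurableSet_safe u v := (G.measurableSet_safe u v).inter b.measurableSet_holds
  rank := G.rank
  height := G.height
  rank_lt := G.rank_lt
  rank_mono := G.rank_mono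

/-- The final vertices of `G` take the place of the source of `H`. -/
def seq (G H : OpenGraph S) : OpenGraph S where
  I := G.I ⊕ H.I
  finite := by
    have := G.finite
    have := H.finite
    infer_instance
  Edge
    | none, .inl v => G.Edge none v
    | some (.inl u), .inl v => G.Edge (some u) v
    | some (.inl u), .inr v => u ∈ G.final ∧ H.Edge none v
    | some (.inr u), .inr v => H.Edge (some u) v
    | _, _ => False
  region := Sum.elim G.region H.region
  safe
    | none, .inl v => G.safe none v
    | some (.inl u), .inl v => G.safe (some u) v
    | some (.inl _), .inr v => H.safe none v
    | some (.inr u), .inr v => H.safe (some u) v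
    | _, _ => univ
  final := Sum.inr '' H.final
  measurableSet_region := by
    rintro (v | v)
    · exact G.measurableSet_region v
    · exact H.measurableSet_region v
  measurableSet_safe := by
    rintro (_ | u | u) (v | v) <;>
      first
        | exact G.measurableSet_safe _ _
        | exact H.measurableSet_safe _ _
        | exact MeasurableSet.univ
  rank := Sum.elim G.rank (fun v => G.height + H.rank v)
  height := G.height + H.height
  rank_lt := by
    rintro (v | v)
    · have := G.rank_lt v
      simp only [Sum.elim_inl]
      omega
    · have := H.rank_lt v
      simp only [Sum.elim_inr]
      omega
  rank_mono := by
    rintro (u | u) (v | v) h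
    · exact G.rank_mono u v h
    · have := G.rank_lt u
      simp only [Sum.elim_inl, Sum.elim_inr]
      omega
    · exact h.elim
    · have := H.rank_mono u v h
      simp only [Sum.elim_inr]
      omega

/-- A common source replaces the sources of `G` and `H`. -/
def or (G H : OpenGraph S) : OpenGraph S where
  I := G.I ⊕ H.I
  finite := by
    have := G.finite
    have := H.finite
    infer_instance
  Edge
    | none, .inl v => G.Edge none v
    | none, .inr v => H.Edge none v
    | some (.inl u), .inl v => G.Edge (some u) v
    | some (.inr u), .inr v => H.Edge (some u) v
    | _, _ => False
  region := Sum.elim G.region H.region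
  safe
    | none, .inl v => G.safe none v
    | none, .inr v => H.safe none v
    | some (.inl u), .inl v => G.safe (some u) v
    | some (.inr u), .inr v => H.safe (some u) v
    | _, _ => univ
  final := Sum.inl '' G.final ∪ Sum.inr '' H.final
  measurableSet_region := by
    rintro (v | v)
    · exact G.measurableSet_region v
    · exact H.measurableSet_region v
  measurableSet_safe := by
    rintro (_ | u | u) (v | v) <;>
      first
        | exact G.measurableSet_safe _ _
        | exact H.measurableSet_safe _ _
        | exact MeasurableSet.univ
  rank := Sum.elim G.rank H.rank
  height := max G.height H.height
  rank_lt := by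
    rintro (v | v)
    · exact lt_max_of_lt_left (G.rank_lt v)
    · exact lt_max_of_lt_right (H.rank_lt v)
  rank_mono := by
    rintro (u | u) (v | v) h
    · exact G.rank_mono u v h
    · exact h.elim
    · exact h.elim
    · exact H.rank_mono u v h

/-- Close the graph: label the source by `X₀` and take the vertex `f` as target. -/
def closeAt (G : OpenGraph S) (X₀ : Set S) (hX₀ : MeasurableSet X₀) (f : G.I) :
    AbstractGraph S X₀ where
  V := Option G.I
  finite := by
    have := G.finite
    infer_instance
  Edge
    | u, some v => G.Edge u v
    | _, none => False
  acyclic := acyclic_of_rank (fun o => o.elim 0 (fun v => G.rank v + 1)) (by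
    rintro (_ | u) (_ | v) h
    · exact h.elim
    · simp
    · exact h.elim
    · simpa using G.rank_mono u v h)
  region
    | none => X₀
    | some v => G.region v
  safe
    | u, some v => G.safe u v
    | _, none => univ
  measurableSet_region := by
    rintro (_ | v)
    · exact hX₀
    · exact G.measurableSet_region v
  measurableSet_safe := by
    rintro u (_ | v)
    · exact MeasurableSet.univ
    · exact G.measurableSet_safe u v
  source := none
  target := some f
  region_source := rfl

/-- Attach a new vertex, with an unconstrained edge from each final vertex. It is the only final
vertex of the resulting graph. -/
def addSink (G : OpenGraph S) : OpenGraph S where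
  I := Option G.I
  finite := by
    have := G.finite
    infer_instance
  Edge
    | none, some v => G.Edge none v
    | some (some u), some v => G.Edge (some u) v
    | some (some u), none => u ∈ G.final
    | _, _ => False
  region
    | none => univ
    | some v => G.region v
  safe
    | none, some v => G.safe none v
    | some (some u), some v => G.safe (some u) v
    | _, _ => univ
  final := {none}
  measurableSet_region := by
    rintro (_ | v)
    · exact MeasurableSet.univ
    · exact G.measurableSet_region v
  measurableSet_safe := by
    rintro (_ | _ | u) (_ | v) <;>
      first
        | exact G.measurableSet_safe _ _
        | exact MeasurableSet.univ
  rank o := o.elim G.height G.rank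
  height := G.height + 1
  rank_lt := by
    rintro (_ | v)
    · exact Nat.lt_succ_self _
    · exact (G.rank_lt v).trans (Nat.lt_succ_self _)
  rank_mono := by
    rintro (_ | u) (_ | v) h
    · exact h.elim
    · exact h.elim
    · exact G.rank_lt u
    · exact G.rank_mono u v h

end OpenGraph

/-- Bottom-up translation along the parse tree. -/
def SpectRL.openGraph {S : Type} [MeasurableSpace S] : SpectRL S → OpenGraph S
  | .achieve b => .achieve b
  | .ensuring φ b => φ.openGraph.ensuring b
  | .seq φ ψ => φ.openGraph.seq ψ.openGraph
  | .or φ ψ => φ.openGraph.or ψ.openGraph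

/-- The abstract graph of a SpectRL formula: a unique final vertex is the target; several final
vertices (which only disjunctions create) are joined to a new target, labelled by all states. -/
def SpectRL.abstractGraph {S : Type} [MeasurableSpace S] (φ : SpectRL S) (X₀ : Set S)
    (hX₀ : MeasurableSet X₀) : AbstractGraph S X₀ :=
  if h : ∃ f, φ.openGraph.final = {f} then φ.openGraph.closeAt X₀ hX₀ h.choose
  else φ.openGraph.addSink.closeAt X₀ hX₀ none

/-! ### Stochastic control systems -/

/-- The system `x_{t+1} = f (x_t, u_t, ω_t)`, with compact state space `X ⊆ ℝⁿ`, Borel action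
space `U ⊆ ℝᵐ`, Borel disturbance space `W ⊆ ℝʳ`, continuous dynamics `f`, and disturbances drawn
independently from the probability distribution `d` on `W`. -/
structure ControlSystem (n m r : ℕ) where
  X : Set (Fin n → ℝ)
  U : Set (Fin m → ℝ)
  W : Set (Fin r → ℝ)
  isCompact_X : IsCompact X
  measurableSet_U : MeasurableSet U
  measurableSet_W : MeasurableSet W
  f : X × U × W → X
  continuous_f : Continuous f
  d : Measure W
  isProbabilityMeasure_d : IsProbabilityMeasure d

attribute [instance] ControlSystem.isProbabilityMeasure_d

/-- A policy with memory. The memory is initialised on the initial state, and updated on each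
later state as soon as that state is observed; the action depends on memory and current state. -/
structure Policy (S A : Type) : Type 1 where
  Mem : Type
  init : S → Mem
  update : Mem → S → Mem
  act : Mem → S → A

section System

variable {n m r : ℕ} (sys : ControlSystem n m r)

/-- A trajectory: a sequence of state-action-disturbance triples that follows the dynamics, with
disturbances in the support of `d`. -/
def IsTrajectory (ρ : ℕ → sys.X × sys.U × sys.W) : Prop :=
  ∀ t, (ρ t).2.2 ∈ sys.d.support ∧ (ρ (t + 1)).1 = sys.f (ρ t)

/-- State and memory at each time, as a function of the disturbance sequence `w`. -/
def run (π : Policy sys.X sys.U) (x₀ : sys.X) (w : ℕ → sys.W) : ℕ → sys.X × π.Mem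
  | 0 => (x₀, π.init x₀)
  | t + 1 =>
    let s := run π x₀ w t
    let y := sys.f (s.1, π.act s.2 s.1, w t)
    (y, π.update s.2 y)

/-- The sequence of states visited under policy `π` from `x₀`. -/
def states (π : Policy sys.X sys.U) (x₀ : sys.X) (w : ℕ → sys.W) (t : ℕ) : sys.X :=
  (run sys π x₀ w t).1

/-- The law of the disturbance sequence. -/
def noise : Measure (ℕ → sys.W) := Measure.infinitePi (fun _ : ℕ => sys.d)

/-- `π` guarantees the probabilistic specification `(φ, p)`: from each initial state, the set of
trajectories that satisfy `φ` is an event and has probability at least `p`. -/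
def Guarantees (X₀ : Set sys.X) (π : Policy sys.X sys.U) (φ : SpectRL sys.X) (p : ℝ) : Prop :=
  ∀ x₀ ∈ X₀, MeasurableSet {w | φ.Sat (states sys π x₀ w)} ∧
    ENNReal.ofReal p ≤ noise sys {w | φ.Sat (states sys π x₀ w)}

/-- `G` is an abstract graph for `φ`: abstract reachability for `G` implies `φ` on each trajectory
from an initial state. -/
def IsAbstractGraphFor {X₀ : Set sys.X} (G : AbstractGraph sys.X X₀) (φ : SpectRL sys.X) : Prop :=
  ∀ ρ, IsTrajectory sys ρ → (ρ 0).1 ∈ X₀ →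
    G.Reachability (fun t => (ρ t).1) → φ.Sat (fun t => (ρ t).1)

/-! ### Reach-avoid tasks and reach-avoid supermartingales -/

/-- A reach-avoid task: from `start`, reach `target` while avoiding `unsafeSet`. -/
structure ReachAvoidTask (S : Type) where
  start : Set S
  target : Set S
  unsafeSet : Set S

/-- The reach-avoid task of the edge `(u, v)`. -/
def AbstractGraph.task {S : Type} [MeasurableSpace S] {X₀ : Set S} (G : AbstractGraph S X₀)
    (u v : G.V) : ReachAvoidTask S where
  start := G.region u
  target := G.region v
  unsafeSet := (G.safe u v)ᶜ

/-- The `ℓ¹` distance. -/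
def l1dist {n : ℕ} (x y : Fin n → ℝ) : ℝ := ∑ i, |x i - y i|

/-- `V` is a `(γ, δ, lam)`-multiplicative reach-avoid supermartingale for the task `τ` and the
system under the memoryless policy `π`. -/
structure IsMultiplicativeRASM (π : sys.X → sys.U) (τ : ReachAvoidTask sys.X) (V : sys.X → ℝ)
    (γ δ lam : ℝ) : Prop where
  gamma_pos : 0 < γ
  gamma_lt_one : γ < 1
  delta_pos : 0 < δ
  one_lt_lam : 1 < lam
  continuous : Continuous V
  nonneg : ∀ x, 0 ≤ V x
  positive : ∀ x, x ∉ τ.target → δ ≤ V x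
  initial : ∀ x ∈ τ.start, V x ≤ 1
  safety : ∀ x ∈ τ.unsafeSet, lam ≤ V x
  decrease : ∀ x, x ∉ τ.target → V x ≤ lam → ∫ ω, V (sys.f (x, π x, ω)) ∂sys.d ≤ γ * V x

/-- What the subprocedure `Policy+RASM` returns when it succeeds on the task `τ` with probability
parameter `q`: a continuous edge policy with a multiplicative RASM, its Lipschitz constant `L` and
a bound `Δ` on the step size, for which the certified lower bound
`1 - γ ^ N / lam`, `N = ⌊(lam - 1) / (L Δ)⌋`, is at least `q`. -/
structure EdgeCertificate (τ : ReachAvoidTask sys.X) (q : ℝ) where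
  policy : C(sys.X, sys.U)
  V : sys.X → ℝ
  γ : ℝ
  δ : ℝ
  lam : ℝ
  isRASM : IsMultiplicativeRASM sys policy τ V γ δ lam
  L : ℝ
  L_pos : 0 < L
  lipschitz : ∀ x y : sys.X, |V x - V y| ≤ L * l1dist (x : Fin n → ℝ) y
  Δ : ℝ
  Δ_pos : 0 < Δ
  bounded_step : ∀ (x : sys.X) (ω : sys.W), l1dist (x : Fin n → ℝ) (sys.f (x, policy x, ω)) ≤ Δ
  bound : q ≤ 1 - 1 / lam * γ ^ ⌊(lam - 1) / (L * Δ)⌋₊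

end System

/-! ### Composition of edge policies -/

/-- An edge policy together with the target region and the safety region of its edge. -/
structure Leg (S A : Type) where
  policy : S → A
  target : Set S
  safe : Set S

/-- `settle x ls i`: the legs from number `i` on are `ls`, and leg `i` is current when state `x` is
observed. Returns the new current leg, and whether it is kept forever: a violated safety
constraint freezes the current leg; a reached target passes control to the next leg, which is
examined at the same state. -/
def settle {S A : Type} (x : S) : List (Leg S A) → ℕ → ℕ × Bool
  | [], i => (i, true)
  | l :: ls, i =>
    if x ∉ l.safe then (i, true)
    else if x ∈ l.target then settle x ls (i + 1)
    else (i, false)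

/-- The global policy that follows the legs `l :: ls` one after the other. Once the last target is
reached, the last edge policy is kept. -/
def composePolicies {S A : Type} (l : Leg S A) (ls : List (Leg S A)) : Policy S A where
  Mem := ℕ × Bool
  init x := settle x (l :: ls) 0
  update mem x := if mem.2 then mem else settle x ((l :: ls).drop mem.1) mem.1
  act mem := ((l :: ls)[mem.1]?.getD ((l :: ls).getLast (List.cons_ne_nil l ls))).policy

section Algorithm

variable {n m r : ℕ} {sys : ControlSystem n m r} {X₀ : Set sys.X}

/-- An edge of `G` with a certified edge policy for its reach-avoid task. -/
structure LearnedEdge (G : AbstractGraph sys.X X₀) where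
  src : G.V
  tgt : G.V
  edge : G.Edge src tgt
  prob : ℝ
  cert : EdgeCertificate sys (G.task src tgt) prob

/-- The leg that follows a learned edge. -/
def LearnedEdge.leg {G : AbstractGraph sys.X X₀} (e : LearnedEdge G) : Leg sys.X sys.U where
  policy := e.cert.policy
  target := G.region e.tgt
  safe := G.safe e.src e.tgt

/-- The list of edges is a path from `u` to `v`. -/
def IsPath {G : AbstractGraph sys.X X₀} : G.V → G.V → List (LearnedEdge G) → Prop
  | u, v, [] => u = v
  | u, v, e :: es => e.src = u ∧ IsPath e.tgt v es

/-- The global policy composed along a nonempty list of learned edges. -/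
def composeEdges {G : AbstractGraph sys.X X₀} (e : LearnedEdge G) (es : List (LearnedEdge G)) :
    Policy sys.X sys.U :=
  composePolicies e.leg (es.map LearnedEdge.leg)

/-- The subprocedure `Policy+RASM` on the reach-avoid tasks of the edges of `G`: any procedure that,
for an edge and a probability parameter, either fails or returns a certified policy. -/
abbrev PolicyRASM (G : AbstractGraph sys.X X₀) : Type :=
  (u v : G.V) → (q : ℝ) → Option (EdgeCertificate sys (G.task u v) q)

/-- `π` is a compositional policy for `(φ, p)` and the abstract graph `G`: it guarantees `(φ, p)`,
and is the composition of edge policies learned by `learn` along a path from source to target. -/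
def IsCompositional (G : AbstractGraph sys.X X₀) (learn : PolicyRASM G) (φ : SpectRL sys.X) (p : ℝ)
    (π : Policy sys.X sys.U) : Prop :=
  Guarantees sys X₀ π φ p ∧
    ∃ (e : LearnedEdge G) (es : List (LearnedEdge G)),
      IsPath G.source G.target (e :: es) ∧
      (∀ e' ∈ e :: es, learn e'.src e'.tgt e'.prob = some e'.cert) ∧
      π = composeEdges e es

/-! ### The algorithm -/

/-- Binary search for the largest parameter in `(lo, hi)` at which `query` succeeds, with the given
number of steps. `best` is the last success. -/
def binarySearch {τ : ReachAvoidTask sys.X} (query : (q : ℝ) → Option (EdgeCertificate sys τ q)) :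
    ℕ → ℝ → ℝ → Option (Σ q : ℝ, EdgeCertificate sys τ q) →
      Option (Σ q : ℝ, EdgeCertificate sys τ q)
  | 0, _, _, best => best
  | k + 1, lo, hi, best =>
    match query ((lo + hi) / 2) with
    | some c => binarySearch query k ((lo + hi) / 2) hi (some ⟨(lo + hi) / 2, c⟩)
    | none => binarySearch query k lo ((lo + hi) / 2) best

/-- The table `Prob` and the edge policies learned so far, with their probabilities. -/
structure PassState (G : AbstractGraph sys.X X₀) where
  prob : G.V → ℝ
  learned : (u v : G.V) → Option (Σ q : ℝ, EdgeCertificate sys (G.task u v) q)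

/-- Processing of the edge `(u, v)`: learn an edge policy by binary search with `prec` steps and
update `Prob[v]`. -/
def processEdge (G : AbstractGraph sys.X X₀) (learn : PolicyRASM G) (prec : ℕ) (v : G.V)
    (st : PassState G) (u : G.V) : PassState G :=
  match binarySearch (learn u v) prec 0 1 none with
  | none => st
  | some c =>
    { prob := Function.update st.prob v (max (st.prob v) (c.1 * st.prob u))
      learned := Function.update st.learned u (Function.update (st.learned u) v (some c)) }

/-- Processing of the vertex `v`: `Prob[v] ← 0`, then treat the edges `(u, v)` with `u ∈ N(v)`. -/
def processVertex (G : AbstractGraph sys.X X₀) (learn : PolicyRASM G) (prec : ℕ) (p : ℝ)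
    (order : List G.V) (st : PassState G) (v : G.V) : PassState G :=
  (order.filter (fun u => G.Edge u v ∧ p ≤ st.prob u)).foldl (processEdge G learn prec v)
    { st with prob := Function.update st.prob v 0 }

/-- The forward pass over the vertices in the given order, starting with `Prob[s] = 1`. -/
def forwardPass (G : AbstractGraph sys.X X₀) (learn : PolicyRASM G) (prec : ℕ) (p : ℝ)
    (order : List G.V) : PassState G :=
  order.tail.foldl (processVertex G learn prec p order)
    { prob := fun v => if v = G.source then 1 else 0
      learned := fun _ _ => none }

/-- `order` lists the vertices in a topological order, from the source to the target. -/
structure IsTopologicalOrder (G : AbstractGraph sys.X X₀) (order : List G.V) : Prop where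
  nodup : order.Nodup
  mem : ∀ v, v ∈ order
  head : order.head? = some G.source
  last : order.getLast? = some G.target
  forward : order.Pairwise (fun u v => ¬ G.Edge v u)

/-- The algorithm outputs `π`: after the forward pass `Prob[t] ≥ p`, and `π` is composed along a
path from source to target of learned edges `(u, v)` with `u ∈ N(v)` and
`Prob[v] = p_{(u,v)} · Prob[u]`. -/
def Outputs (G : AbstractGraph sys.X X₀) (learn : PolicyRASM G) (prec : ℕ) (p : ℝ)
    (order : List G.V) (π : Policy sys.X sys.U) : Prop :=
  p ≤ (forwardPass G learn prec p order).prob G.target ∧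
    ∃ (e : LearnedEdge G) (es : List (LearnedEdge G)),
      IsPath G.source G.target (e :: es) ∧
      (∀ e' ∈ e :: es,
        p ≤ (forwardPass G learn prec p order).prob e'.src ∧
        (forwardPass G learn prec p order).learned e'.src e'.tgt = some ⟨e'.prob, e'.cert⟩ ∧
        (forwardPass G learn prec p order).prob e'.tgt =
          e'.prob * (forwardPass G learn prec p order).prob e'.src) ∧
      π = composeEdges e es

end Algorithm

end Claps

end

/-!
The translation is sound because a path in the graph of a formula can be cut at the seams of the
construction: by induction on the formula, every piece of trajectory that follows a path from the
source to a final vertex satisfies the formula (`SpectRL.satOn_of_reaches`).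

For the probabilistic part, let `e₁, …, e_k` be the edges along which the output policy is composed.
Each prefix of the forward pass fixes the entries that later vertices use, so `Prob[t]` is the
product of the certified parameters along the path (`prob_eq_pathProb_mul`,
`forwardPass_prob_source`), and it is enough to bound the probability of abstract reachability from
below by this product. `Succeeds T es x w` is a stronger event with a time bound `T`, in which the
supermartingale `V` of the current edge also stays below its level `lam`; it is defined by recursion
on `T` and on the remaining edges, so that the Markov property is needed for one step only
(`noise_not_succeeds_succ`). When the current edge has been followed for `k` steps, and the edges
`es` remain after it, the probability of not succeeding is at most `failBound`, an affine function
of `V` with two parts.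

* The probability of violating the current edge is at most `γ ^ (N - k) / lam * V`. This does not
  increase in expectation, because `V` contracts by `γ`; it is at least `1` at a violation, which
  cannot occur before step `N` since `V` grows by `L * Δ` at most in each step; and it is at most
  `1 - q` when the edge is entered. Later edges contribute through the product of their parameters.
* The expected number of remaining steps is bounded through `V`, which decreases in expectation by
  `(1 - γ) * δ` at least while the target is not reached. By Markov's inequality, the probability of
  not having finished or failed after `T` steps is of order `1 / T`.

Induction on `T` and on the remaining edges gives `noise_not_succeeds_le`, and the time bound is
removed by letting `T` tend to infinity (`guarantees_composeEdges`). The event `Succeeds` implies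
abstract reachability for each disturbance sequence (`follows_of_succeeds`), and almost every such
sequence has its values in the support, so that the trajectory satisfies the formula.

A path exists when `Prob[t] ≥ p > 0`, because a positive entry of a vertex other than the source is
the product of a certified parameter and the entry of a predecessor whose entry is at least `p`
(`exists_learned_of_prob_pos`), and the graph is finite and acyclic.
-/

namespace Claps

/-! ### Soundness of the translation of formulas into graphs -/

/-- Runs in a graph under construction: `G.Reaches x a u c` says that some path from the source to
`u` is followed by the state sequence `x` from time `a` to time `c`. The region of the source is
not constrained. -/
inductive OpenGraph.Reaches {S : Type} [MeasurableSpace S] (G : OpenGraph S) (x : ℕ → S) (a : ℕ) :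
    Option G.I → ℕ → Prop
  | source : G.Reaches x a none a
  | step (u : Option G.I) (v : G.I) (b c : ℕ) : G.Reaches x a u b → b ≤ c → G.Edge u v →
      x c ∈ G.region v → (∀ t, b ≤ t → t ≤ c → x t ∈ G.safe u v) → G.Reaches x a (some v) c

namespace OpenGraph

variable {S : Type} [MeasurableSpace S] {G H : OpenGraph S} {x : ℕ → S} {a c : ℕ}

theorem Reaches.le {u : Option G.I} (h : G.Reaches x a u c) : a ≤ c := by
  induction h with
  | source => exact le_rfl
  | step u v b c _ hbc _ _ _ ih => exact ih.trans hbc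

theorem Reaches.eq_of_source (h : G.Reaches x a none c) : c = a := by
  cases h
  rfl

theorem Reaches.of_ensuring {b : Predicate S} {u : Option (G.ensuring b).I}
    (h : (G.ensuring b).Reaches x a u c) :
    G.Reaches x a u c ∧ ∀ v, u = some v → ∀ t, a ≤ t → t ≤ c → x t ∈ b.holds := by
  induction h with
  | source => exact ⟨.source, fun v hv => by cases hv⟩
  | step u v d c hr hdc he hv hs ih =>
    refine ⟨Reaches.step (G := G) u v d c ih.1 hdc he hv fun t h1 h2 => (hs t h1 h2).1,
      fun w _ t h1 h2 => ?_⟩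
    rcases le_total d t with hd | hd
    · exact (hs t hd h2).2
    · cases u with
      | none =>
        -- only the empty run ends at the source, so the first edge covers the whole time interval
        obtain rfl := Reaches.eq_of_source (G := G) ih.1
        exact (hs t h1 h2).2
      | some u => exact ih.2 u rfl t h1 hd

theorem Reaches.of_seq {u : Option (G.seq H).I} (h : (G.seq H).Reaches x a u c) :
    (u = none → c = a) ∧ (∀ v, u = some (.inl v) → G.Reaches x a (some v) c) ∧
      ∀ v, u = some (.inr v) →
        ∃ f ∈ G.final, ∃ t, G.Reaches x a (some f) t ∧ H.Reaches x t (some v) c := by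
  induction h with
  | source => exact ⟨fun _ => rfl, fun v hv => (by cases hv), fun v hv => (by cases hv)⟩
  | step u v d c hr hdc he hv hs ih =>
    obtain ⟨ih0, ih1, ih2⟩ := ih
    refine ⟨fun h => (by cases h), fun w hw => ?_, fun w hw => ?_⟩
    · cases hw
      rcases u with _ | u | u
      · obtain rfl := ih0 rfl
        exact .step none w d c .source hdc he hv hs
      · exact .step (some u) w d c (ih1 u rfl) hdc he hv hs
      · exact he.elim
    · cases hw
      rcases u with _ | u | u
      · exact he.elim
      · exact ⟨u, he.1, d, ih1 u rfl, .step none w d c .source hdc he.2 hv hs⟩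
      · obtain ⟨f, hf, t, h1, h2⟩ := ih2 u rfl
        exact ⟨f, hf, t, h1, .step (some u) w d c h2 hdc he hv hs⟩

theorem Reaches.of_or {u : Option (G.or H).I} (h : (G.or H).Reaches x a u c) :
    (u = none → c = a) ∧ (∀ v, u = some (.inl v) → G.Reaches x a (some v) c) ∧
      ∀ v, u = some (.inr v) → H.Reaches x a (some v) c := by
  induction h with
  | source => exact ⟨fun _ => rfl, fun v hv => (by cases hv), fun v hv => (by cases hv)⟩
  | step u v d c hr hdc he hv hs ih =>
    obtain ⟨ih0, ih1, ih2⟩ := ih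
    refine ⟨fun h => (by cases h), fun w hw => ?_, fun w hw => ?_⟩
    · cases hw
      rcases u with _ | u | u
      · obtain rfl := ih0 rfl
        exact .step none w d c .source hdc he hv hs
      · exact .step (some u) w d c (ih1 u rfl) hdc he hv hs
      · exact he.elim
    · cases hw
      rcases u with _ | u | u
      · obtain rfl := ih0 rfl
        exact .step none w d c .source hdc he hv hs
      · exact he.elim
      · exact .step (some u) w d c (ih2 u rfl) hdc he hv hs

theorem Reaches.of_addSink {u : Option G.addSink.I} (h : G.addSink.Reaches x a u c) :
    (u = none → c = a) ∧ (∀ v, u = some (some v) → G.Reaches x a (some v) c) ∧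
      (u = some none → ∃ f ∈ G.final, ∃ t, G.Reaches x a (some f) t) := by
  induction h with
  | source => exact ⟨fun _ => rfl, fun v hv => (by cases hv), fun hv => (by cases hv)⟩
  | step u v d c hr hdc he hv hs ih =>
    obtain ⟨ih0, ih1, ih2⟩ := ih
    refine ⟨fun h => (by cases h), fun w hw => ?_, fun hw => ?_⟩
    · cases hw
      rcases u with _ | _ | u
      · obtain rfl := ih0 rfl
        exact .step none w d c .source hdc he hv hs
      · exact he.elim
      · exact .step (some u) w d c (ih1 u rfl) hdc he hv hs
    · cases hw
      rcases u with _ | _ | u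
      · exact he.elim
      · exact he.elim
      · exact ⟨u, he, d, ih1 u rfl⟩

theorem reaches_of_reachability_closeAt {X₀ : Set S} {hX₀ : MeasurableSet X₀} {f : G.I}
    (h : (G.closeAt X₀ hX₀ f).Reachability x) : ∃ c, G.Reaches x 0 (some f) c := by
  obtain ⟨k, i, v, hi0, hv0, hvk, hE, hr, hs⟩ := h
  have key : ∀ j, j ≤ k → G.Reaches x 0 (v j) (i j) := by
    intro j
    induction j with
    | zero =>
      intro _
      rw [hi0, hv0]
      exact .source
    | succ j ih =>
      intro hj
      have hE' := hE j hj
      have hr' := hr (j + 1) hj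
      have hs' := hs j hj
      have ih' := ih (by omega)
      generalize v (j + 1) = y at hE' hr' hs' ⊢
      cases y with
      | none => exact hE'.2.elim
      | some y => exact .step (v j) y (i j) _ ih' hE'.1 hE'.2 hr' hs'
  have := key k le_rfl
  rw [hvk] at this
  exact ⟨_, this⟩

end OpenGraph

/-- A run to a final vertex of the graph of `φ` is a piece of trajectory that satisfies `φ`. -/
theorem SpectRL.satOn_of_reaches {S : Type} [MeasurableSpace S] (φ : SpectRL S) {x : ℕ → S} :
    ∀ {a c : ℕ} {v : φ.openGraph.I}, v ∈ φ.openGraph.final →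
      φ.openGraph.Reaches x a (some v) c → φ.SatOn x a c := by
  induction φ with
  | achieve b =>
    intro a c v _ h
    have hac := h.le
    cases h with
    | step u _ d _ hr hdc he hv hs => exact ⟨c, hac, le_rfl, hv⟩
  | ensuring φ b ih =>
    intro a c v hv h
    obtain ⟨h1, h2⟩ := OpenGraph.Reaches.of_ensuring h
    exact ⟨ih hv h1, h2 v rfl⟩
  | seq φ ψ ihφ ihψ =>
    rintro a c v ⟨w, hw, rfl⟩ h
    obtain ⟨f, hf, t, h1, h2⟩ := (OpenGraph.Reaches.of_seq h).2.2 w rfl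
    exact ⟨t, h1.le, h2.le, ihφ hf h1, ihψ hw h2⟩
  | or φ ψ ihφ ihψ =>
    rintro a c v (⟨w, hw, rfl⟩ | ⟨w, hw, rfl⟩) h
    · exact Or.inl (ihφ hw ((OpenGraph.Reaches.of_or h).2.1 w rfl))
    · exact Or.inr (ihψ hw ((OpenGraph.Reaches.of_or h).2.2 w rfl))

theorem SpectRL.sat_of_reachability {S : Type} [MeasurableSpace S] (φ : SpectRL S) {X₀ : Set S}
    {hX₀ : MeasurableSet X₀} {x : ℕ → S} (h : (φ.abstractGraph X₀ hX₀).Reachability x) :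
    φ.Sat x := by
  unfold SpectRL.abstractGraph at h
  split_ifs at h with hf
  · obtain ⟨c, hc⟩ := OpenGraph.reaches_of_reachability_closeAt h
    refine ⟨c, φ.satOn_of_reaches ?_ hc⟩
    exact (Set.ext_iff.mp hf.choose_spec _).mpr rfl
  · obtain ⟨c, hc⟩ := OpenGraph.reaches_of_reachability_closeAt h
    obtain ⟨f, hf, t, ht⟩ := (OpenGraph.Reaches.of_addSink hc).2.2 rfl
    exact ⟨t, φ.satOn_of_reaches hf ht⟩

/-! ### The disturbance sequence -/

section Noise

variable {n m r : ℕ} (sys : ControlSystem n m r)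

instance : IsProbabilityMeasure (noise sys) := by
  unfold noise
  infer_instance

/-- The first disturbance and the sequence of the later ones are independent, and the latter has
the law of the whole sequence. -/
theorem measurePreserving_head_tail :
    MeasurePreserving (fun w : ℕ → sys.W => (w 0, fun t => w (t + 1))) (noise sys)
      (sys.d.prod (noise sys)) := by
  let cons : sys.W × (ℕ → sys.W) → ℕ → sys.W := fun q t => Nat.casesOn t q.1 q.2
  have hcons : Measurable cons := by
    refine measurable_pi_lambda _ fun t => ?_
    cases t with
    | zero => exact measurable_fst
    | succ t => exact (measurable_pi_apply t).comp measurable_snd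
  have hsplit : Measurable (fun w : ℕ → sys.W => (w 0, fun t => w (t + 1))) :=
    (measurable_pi_apply 0).prodMk (measurable_pi_lambda _ fun t => measurable_pi_apply (t + 1))
  have key : (sys.d.prod (noise sys)).map cons = noise sys := by
    refine Measure.eq_infinitePi _ fun s t ht => ?_
    -- the box is written over an initial segment of the coordinates
    obtain ⟨N, hN⟩ : ∃ N, s ⊆ Finset.range (N + 1) := by
      obtain ⟨N, hN⟩ := s.exists_nat_subset_range
      exact ⟨N, hN.trans (Finset.range_subset_range.mpr (Nat.le_succ N))⟩
    let t' : ℕ → Set sys.W := fun i => if i ∈ s then t i else univ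
    have ht' : ∀ i, MeasurableSet (t' i) := by
      intro i
      by_cases hi : i ∈ s
      · simp only [t', if_pos hi, ht i]
      · simp only [t', if_neg hi, MeasurableSet.univ]
    have hpre : cons ⁻¹' (Set.pi s t) =
        t' 0 ×ˢ (Set.pi (Finset.range N) fun i => t' (i + 1)) := by
      ext q
      simp only [mem_preimage, Set.mem_pi, mem_prod, Finset.mem_coe, Finset.mem_range, t']
      constructor
      · intro h
        refine ⟨?_, fun i _ => ?_⟩
        · split_ifs with h0
          · exact h 0 h0
          · trivial
        · split_ifs with h0
          · exact h (i + 1) h0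
          · trivial
      · rintro ⟨h0, h1⟩ i hi
        cases i with
        | zero => rwa [if_pos hi] at h0
        | succ i =>
          have := h1 i (by have := Finset.mem_range.mp (hN hi); omega)
          rwa [if_pos hi] at this
    rw [Measure.map_apply hcons (MeasurableSet.pi s.countable_toSet fun i _ => ht i), hpre,
      Measure.prod_prod, noise, Measure.infinitePi_pi _ fun i _ => ht' (i + 1), mul_comm,
      ← Finset.prod_range_succ' (fun i => sys.d (t' i)) N]
    rw [← Finset.prod_subset hN (fun i _ hi => ?_)]
    · exact Finset.prod_congr rfl fun i hi => by simp only [t', if_pos hi]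
    · simp only [t', if_neg hi, measure_univ]
  refine ⟨hsplit, ?_⟩
  conv_lhs => rw [← key]
  rw [Measure.map_map hsplit hcons]
  exact Measure.map_id

theorem ae_mem_support : ∀ᵐ w ∂noise sys, ∀ t, w t ∈ sys.d.support := by
  rw [ae_all_iff]
  intro t
  exact (measurePreserving_eval_infinitePi (fun _ : ℕ => sys.d) t).quasiMeasurePreserving.ae
    (Measure.support_mem_ae (μ := sys.d))

end Noise

/-! ### Measurability of the satisfaction event -/

section Measurability

theorem SpectRL.measurableSet_satOn {S : Type} [MeasurableSpace S] (φ : SpectRL S) :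
    ∀ a b : ℕ, MeasurableSet {x : ℕ → S | φ.SatOn x a b} := by
  have hpred : ∀ (p : Predicate S) (t : ℕ), MeasurableSet {x : ℕ → S | x t ∈ p.holds} :=
    fun p t => measurable_pi_apply t p.measurableSet_holds
  induction φ with
  | achieve p =>
    intro a b
    simp only [SpectRL.SatOn, ofPred_exists, ofPred_and]
    exact .iUnion fun t => (MeasurableSet.const _).inter ((MeasurableSet.const _).inter (hpred p t))
  | ensuring φ p ih =>
    intro a b
    simp only [SpectRL.SatOn, ofPred_and, ofPred_forall]
    exact (ih a b).inter (.iInter fun t => .iInter fun _ => .iInter fun _ => hpred p t)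
  | seq φ ψ ihφ ihψ =>
    intro a b
    simp only [SpectRL.SatOn, ofPred_exists, ofPred_and]
    exact .iUnion fun t => (MeasurableSet.const _).inter
      ((MeasurableSet.const _).inter ((ihφ a t).inter (ihψ t b)))
  | or φ ψ ihφ ihψ =>
    intro a b
    exact (ihφ a b).union (ihψ a b)

theorem SpectRL.measurableSet_sat {S : Type} [MeasurableSpace S] (φ : SpectRL S) :
    MeasurableSet {x : ℕ → S | φ.Sat x} := by
  simp only [SpectRL.Sat, ofPred_exists]
  exact .iUnion fun K => φ.measurableSet_satOn 0 K

theorem measurable_settle {S A : Type} [MeasurableSpace S] (ls : List (Leg S A))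
    (h : ∀ l ∈ ls, MeasurableSet l.target ∧ MeasurableSet l.safe) (i : ℕ) :
    Measurable fun x => settle x ls i := by
  induction ls generalizing i with
  | nil => exact measurable_const
  | cons l ls ih =>
    have hl := h l (by simp)
    refine Measurable.ite hl.2.compl measurable_const (Measurable.ite hl.1 ?_ measurable_const)
    exact ih (fun l' hl' => h l' (by simp [hl'])) (i + 1)

variable {n m r : ℕ} {sys : ControlSystem n m r}

theorem measurable_states_composePolicies (l : Leg sys.X sys.U) (ls : List (Leg sys.X sys.U))
    (h : ∀ l' ∈ l :: ls,
      Measurable l'.policy ∧ MeasurableSet l'.target ∧ MeasurableSet l'.safe) (x₀ : sys.X) :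
    Measurable fun w => states sys (composePolicies l ls) x₀ w := by
  have hact : Measurable fun q : (ℕ × Bool) × sys.X => (composePolicies l ls).act q.1 q.2 := by
    refine measurable_from_prod_countable_right fun mem => ?_
    refine (h (((l :: ls)[mem.1]?).getD ((l :: ls).getLast (List.cons_ne_nil l ls))) ?_).1
    cases hm : (l :: ls)[mem.1]? with
    | none => exact List.getLast_mem _
    | some l' => exact List.mem_of_getElem? hm
  have hupd : Measurable (β := ℕ × Bool) fun q : (ℕ × Bool) × sys.X =>
      (composePolicies l ls).update q.1 q.2 := by
    refine measurable_from_prod_countable_right fun mem => ?_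
    change Measurable fun x => if mem.2 then mem else settle x ((l :: ls).drop mem.1) mem.1
    split_ifs
    · exact measurable_const
    · exact measurable_settle _ (fun l' hl' => (h l' (List.mem_of_mem_drop hl')).2) _
  have key : ∀ t, Measurable (fun w => (run sys (composePolicies l ls) x₀ w t).1) ∧
      Measurable (β := ℕ × Bool) (fun w => (run sys (composePolicies l ls) x₀ w t).2) := by
    intro t
    induction t with
    | zero => exact ⟨measurable_const, measurable_const⟩
    | succ t ih =>
      have h1 : Measurable fun w => (run sys (composePolicies l ls) x₀ w (t + 1)).1 :=
        sys.continuous_f.measurable.comp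
          (ih.1.prodMk ((hact.comp (ih.2.prodMk ih.1)).prodMk (measurable_pi_apply t)))
      exact ⟨h1, hupd.comp (ih.2.prodMk h1)⟩
  exact measurable_pi_lambda _ fun t => (key t).1

end Measurability

section Runs

variable {n m r : ℕ} {sys : ControlSystem n m r} {X₀ : Set sys.X} {G : AbstractGraph sys.X X₀}

theorem measurable_states_composeEdges (e : LearnedEdge G) (es : List (LearnedEdge G))
    (x₀ : sys.X) : Measurable fun w => states sys (composeEdges e es) x₀ w := by
  refine measurable_states_composePolicies _ _ (fun l hl => ?_) x₀
  rw [← List.map_cons (f := LearnedEdge.leg), List.mem_map] at hl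
  obtain ⟨e', _, rfl⟩ := hl
  exact ⟨e'.cert.policy.continuous.measurable, G.measurableSet_region _, G.measurableSet_safe _ _⟩

/-! ### Success of a composed policy within a time bound -/

/-- `Follows x es a`: from time `a` on, the state sequence `x` traverses the edges `es` one after
the other, reaching the region of each end point while staying in the safety label of the edge. -/
def Follows (x : ℕ → sys.X) : List (LearnedEdge G) → ℕ → Prop
  | [], _ => True
  | e :: es, a => ∃ c, a ≤ c ∧ x c ∈ G.region e.tgt ∧
      (∀ t, a ≤ t → t ≤ c → x t ∈ G.safe e.src e.tgt) ∧ Follows x es c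

theorem Follows.exists_path {x : ℕ → sys.X} {es : List (LearnedEdge G)} :
    ∀ {u v : G.V} {a : ℕ}, IsPath u v es → x a ∈ G.region u → Follows x es a →
      ∃ (k : ℕ) (i : ℕ → ℕ) (y : ℕ → G.V), i 0 = a ∧ y 0 = u ∧ y k = v ∧
        (∀ j < k, i j ≤ i (j + 1) ∧ G.Edge (y j) (y (j + 1))) ∧
        (∀ j ≤ k, x (i j) ∈ G.region (y j)) ∧
        (∀ j < k, ∀ t, i j ≤ t → t ≤ i (j + 1) → x t ∈ G.safe (y j) (y (j + 1))) := by
  induction es with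
  | nil =>
    intro u v a hp hu _
    exact ⟨0, fun _ => a, fun _ => u, rfl, rfl, hp, fun j hj => (by omega), fun _ _ => hu,
      fun j hj => (by omega)⟩
  | cons e es ih =>
    rintro u v a ⟨rfl, hp⟩ hu ⟨c, hac, hc, hs, hf⟩
    obtain ⟨k, i, y, hi0, hy0, hyk, h1, h2, h3⟩ := ih hp hc hf
    refine ⟨k + 1, fun j => Nat.casesOn j a i, fun j => Nat.casesOn j e.src y, rfl, rfl, hyk,
      fun j hj => ?_, fun j hj => ?_, fun j hj => ?_⟩
    · cases j with
      | zero =>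
        change a ≤ i 0 ∧ G.Edge e.src (y 0)
        rw [hi0, hy0]
        exact ⟨hac, e.edge⟩
      | succ j => exact h1 j (by omega)
    · cases j with
      | zero => exact hu
      | succ j => exact h2 j (by omega)
    · cases j with
      | zero =>
        change ∀ t, a ≤ t → t ≤ i 0 → x t ∈ G.safe e.src (y 0)
        rw [hi0, hy0]
        exact hs
      | succ j => exact h3 j (by omega)

theorem Follows.reachability {x : ℕ → sys.X} {es : List (LearnedEdge G)}
    (hp : IsPath G.source G.target es) (hx : x 0 ∈ X₀) (hf : Follows x es 0) :
    G.Reachability x :=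
  hf.exists_path hp (by rwa [G.region_source])

/-- `Succeeds T es x w`: from state `x` and under the disturbances `w`, the policies of the edges
`es`, followed one after the other, reach the last target within `T` steps in total, and the
supermartingale of the current edge stays below its safety level `lam` throughout. This implies the
safety constraints, and it is stronger: the supermartingale may exceed `lam` inside the safety
label, where it need no longer decrease in expectation. -/
def Succeeds : ℕ → List (LearnedEdge G) → sys.X → (ℕ → sys.W) → Prop
  | _, [], _, _ => True
  | 0, e :: es, x, w => e.cert.V x < e.cert.lam ∧ x ∈ G.region e.tgt ∧ Succeeds 0 es x w
  | T + 1, e :: es, x, w => e.cert.V x < e.cert.lam ∧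
      if x ∈ G.region e.tgt then Succeeds (T + 1) es x w
      else Succeeds T (e :: es) (sys.f (x, e.cert.policy x, w 0)) (fun t => w (t + 1))
termination_by T es => T + es.length

theorem measurableSet_succeeds (T : ℕ) (es : List (LearnedEdge G)) :
    MeasurableSet {q : sys.X × (ℕ → sys.W) | Succeeds T es q.1 q.2} := by
  have hV : ∀ e : LearnedEdge G,
      MeasurableSet {q : sys.X × (ℕ → sys.W) | e.cert.V q.1 < e.cert.lam} := fun e =>
    measurableSet_lt (e.cert.isRASM.continuous.measurable.comp measurable_fst) measurable_const
  have hR : ∀ e : LearnedEdge G,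
      MeasurableSet {q : sys.X × (ℕ → sys.W) | q.1 ∈ G.region e.tgt} := fun e =>
    measurable_fst (G.measurableSet_region e.tgt)
  induction T generalizing es with
  | zero =>
    induction es with
    | nil => simp only [Succeeds, ofPred_true, MeasurableSet.univ]
    | cons e es ih =>
      simp only [Succeeds]
      exact (hV e).inter ((hR e).inter ih)
  | succ T ihT =>
    induction es with
    | nil => simp only [Succeeds, ofPred_true, MeasurableSet.univ]
    | cons e es ih =>
      let step : sys.X × (ℕ → sys.W) → sys.X × (ℕ → sys.W) := fun q =>
        (sys.f (q.1, e.cert.policy q.1, q.2 0), fun t => q.2 (t + 1))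
      have hstep : Measurable step := by
        refine Measurable.prodMk (sys.continuous_f.measurable.comp (measurable_fst.prodMk
          ((e.cert.policy.continuous.measurable.comp measurable_fst).prodMk
            ((measurable_pi_apply 0).comp measurable_snd)))) ?_
        exact measurable_pi_lambda _ fun t => (measurable_pi_apply (t + 1)).comp measurable_snd
      have hset : {q : sys.X × (ℕ → sys.W) | Succeeds (T + 1) (e :: es) q.1 q.2} =
          {q | e.cert.V q.1 < e.cert.lam} ∩ ({q | q.1 ∈ G.region e.tgt} ∩
            {q | Succeeds (T + 1) es q.1 q.2} ∪ {q | q.1 ∈ G.region e.tgt}ᶜ ∩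
            step ⁻¹' {q | Succeeds T (e :: es) q.1 q.2}) := by
        ext q
        by_cases hq : q.1 ∈ G.region e.tgt <;> simp [Succeeds, hq, step]
      rw [hset]
      exact (hV e).inter (((hR e).inter ih).union ((hR e).compl.inter (hstep (ihT (e :: es)))))

/-- The states visited by the composed policy traverse the edges whenever the policy succeeds. The
memory `settle x ls i` is the one formed when `x` is observed with the legs from number `i` on still
to be followed. -/
theorem follows_of_succeeds (e₀ : LearnedEdge G) (es₀ : List (LearnedEdge G)) (x₀ : sys.X)
    (w : ℕ → sys.W) (T : ℕ) :
    ∀ (es : List (LearnedEdge G)) (i t : ℕ) (x : sys.X), (e₀ :: es₀).drop i = es →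
      run sys (composeEdges e₀ es₀) x₀ w t = (x, settle x (es.map LearnedEdge.leg) i) →
      Succeeds T es x (fun s => w (t + s)) →
      Follows (states sys (composeEdges e₀ es₀) x₀ w) es t := by
  have hsafe : ∀ (e : LearnedEdge G) x, e.cert.V x < e.cert.lam → x ∈ G.safe e.src e.tgt := by
    intro e x hx
    by_contra hns
    exact absurd (e.cert.isRASM.safety x hns) (not_le.mpr hx)
  -- an edge whose target contains the current state is traversed without any step
  have hskip : ∀ (e : LearnedEdge G) (es : List (LearnedEdge G)) (i t : ℕ) (x : sys.X),
      (e₀ :: es₀).drop i = e :: es →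
      run sys (composeEdges e₀ es₀) x₀ w t = (x, settle x ((e :: es).map LearnedEdge.leg) i) →
      e.cert.V x < e.cert.lam → x ∈ G.region e.tgt →
      ((∀ i : ℕ, (e₀ :: es₀).drop i = es →
        run sys (composeEdges e₀ es₀) x₀ w t = (x, settle x (es.map LearnedEdge.leg) i) →
        Follows (states sys (composeEdges e₀ es₀) x₀ w) es t)) →
      Follows (states sys (composeEdges e₀ es₀) x₀ w) (e :: es) t := by
    intro e es i t x hd hrun hV hx ih
    have hst : states sys (composeEdges e₀ es₀) x₀ w t = x := by
      simp only [states, hrun]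
    refine ⟨t, le_rfl, hst.symm ▸ hx, fun s h1 h2 => ?_, ih (i + 1) ?_ ?_⟩
    · rw [le_antisymm h2 h1, hst]
      exact hsafe e x hV
    · rw [← List.tail_drop, hd, List.tail_cons]
    · have hmem : settle x ((e :: es).map LearnedEdge.leg) i =
          settle x (es.map LearnedEdge.leg) (i + 1) := by
        rw [List.map_cons, settle, if_neg (not_not.mpr (show x ∈ e.leg.safe from hsafe e x hV)),
          if_pos (show x ∈ e.leg.target from hx)]
      rw [hmem] at hrun
      exact hrun
  induction T with
  | zero =>
    intro es
    induction es with
    | nil => intros; trivial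
    | cons e es ih =>
      intro i t x hd hrun hs
      rw [Succeeds] at hs
      exact hskip e es i t x hd hrun hs.1 hs.2.1 fun j hj hr => ih j t x hj hr hs.2.2
  | succ T ihT =>
    intro es
    induction es with
    | nil => intros; trivial
    | cons e es ih =>
      intro i t x hd hrun hs
      rw [Succeeds] at hs
      by_cases hx : x ∈ G.region e.tgt
      · rw [if_pos hx] at hs
        exact hskip e es i t x hd hrun hs.1 hx fun j hj hr => ih j t x hj hr hs.2
      · rw [if_neg hx] at hs
        have hst : states sys (composeEdges e₀ es₀) x₀ w t = x := by
          simp only [states, hrun]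
        have hmem : settle x ((e :: es).map LearnedEdge.leg) i = (i, false) := by
          rw [List.map_cons, settle, if_neg (not_not.mpr (show x ∈ e.leg.safe from hsafe e x hs.1)),
            if_neg (show x ∉ e.leg.target from hx)]
        have hget : (e₀.leg :: es₀.map LearnedEdge.leg)[i]? = some e.leg := by
          have h0 : ((e₀ :: es₀).drop i)[0]? = some e := by rw [hd]; rfl
          rw [List.getElem?_drop, Nat.add_zero] at h0
          rw [← List.map_cons, List.getElem?_map, h0]
          rfl
        have hrun' : run sys (composeEdges e₀ es₀) x₀ w (t + 1) =
            (sys.f (x, e.cert.policy x, w t),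
              settle (sys.f (x, e.cert.policy x, w t)) ((e :: es).map LearnedEdge.leg) i) := by
          have hact : (composeEdges e₀ es₀).act (i, false) x = e.cert.policy x := by
            simp only [composeEdges, composePolicies, hget, Option.getD_some]
            rfl
          rw [hmem] at hrun
          simp only [run, hrun, hact]
          simp only [composeEdges, composePolicies, ← List.map_cons, ← List.map_drop, hd]
          rfl
        obtain ⟨c, hc, hcr, hcs, hf⟩ := ihT (e :: es) i (t + 1) _ hd hrun' (by
          simpa only [Nat.add_zero, Nat.add_assoc, Nat.add_comm 1] using hs.2)
        refine ⟨c, by omega, hcr, fun s h1 h2 => ?_, hf⟩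
        rcases h1.eq_or_lt with rfl | h1
        · rw [hst]
          exact hsafe e x hs.1
        · exact hcs s h1 h2

end Runs

/-! ### The failure probability of a composed policy -/

section FailureBound

variable {n m r : ℕ} {sys : ControlSystem n m r} {X₀ : Set sys.X} {G : AbstractGraph sys.X X₀}

/-- The product of the certified probabilities along a list of edges. -/
def pathProb (es : List (LearnedEdge G)) : ℝ := (es.map LearnedEdge.prob).prod

namespace LearnedEdge

/-- As long as the target of `e` is not reached and `V ≤ lam`, the function `e.slowness * V`
decreases in expectation by at least one per step. -/
noncomputable def slowness (e : LearnedEdge G) : ℝ := 1 / ((1 - e.cert.γ) * e.cert.δ)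

/-- The coefficient `γ ^ (N - k) / lam` of the supermartingale in the bound for the failure
probability, when the policy of `e` has been followed for `k` steps. -/
noncomputable def risk (e : LearnedEdge G) (k : ℕ) : ℝ :=
  e.cert.γ ^ ⌊(e.cert.lam - 1) / (e.cert.L * e.cert.Δ)⌋₊ / e.cert.γ ^ k / e.cert.lam

variable (e : LearnedEdge G)

theorem lam_pos : 0 < e.cert.lam := one_pos.trans e.cert.isRASM.one_lt_lam

theorem slowness_pos : 0 < e.slowness :=
  one_div_pos.mpr (mul_pos (sub_pos.mpr e.cert.isRASM.gamma_lt_one) e.cert.isRASM.delta_pos)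

theorem risk_pos (k : ℕ) : 0 < e.risk k := by
  have := e.cert.isRASM.gamma_pos
  have := e.lam_pos
  unfold risk
  positivity

theorem risk_succ_mul (k : ℕ) : e.risk (k + 1) * e.cert.γ = e.risk k := by
  have := e.cert.isRASM.gamma_pos.ne'
  have := e.lam_pos.ne'
  unfold risk
  field_simp
  rw [pow_succ']

theorem prob_le : e.prob ≤ 1 - e.risk 0 := by
  refine e.cert.bound.trans_eq ?_
  unfold risk
  rw [pow_zero, div_one, one_div, inv_mul_eq_div]

/-- The level `lam` cannot be reached in fewer than `N = ⌊(lam - 1) / (L * Δ)⌋` steps, since the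
supermartingale starts at `1` at most and grows by `L * Δ` at most in each step. After `N` steps the
coefficient is at least `1 / lam`. -/
theorem one_le_risk_mul {k : ℕ} {x : sys.X} (hk : e.cert.V x ≤ 1 + k * (e.cert.L * e.cert.Δ))
    (hx : e.cert.lam ≤ e.cert.V x) : 1 ≤ e.risk k * e.cert.V x := by
  have hγ := e.cert.isRASM.gamma_pos
  have hl := e.lam_pos
  have hN : ⌊(e.cert.lam - 1) / (e.cert.L * e.cert.Δ)⌋₊ ≤ k := by
    refine Nat.floor_le_of_le ?_
    rw [div_le_iff₀ (mul_pos e.cert.L_pos e.cert.Δ_pos)]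
    linarith
  have hpow : 1 ≤ e.cert.γ ^ ⌊(e.cert.lam - 1) / (e.cert.L * e.cert.Δ)⌋₊ / e.cert.γ ^ k :=
    (one_le_div (pow_pos hγ k)).mpr
      (pow_le_pow_of_le_one hγ.le e.cert.isRASM.gamma_lt_one.le hN)
  unfold risk
  rw [div_mul_eq_mul_div, one_le_div hl]
  exact hx.trans (le_mul_of_one_le_left (e.cert.isRASM.nonneg x) hpow)

theorem V_step_le (x : sys.X) (ω : sys.W) :
    e.cert.V (sys.f (x, e.cert.policy x, ω)) ≤ e.cert.V x + e.cert.L * e.cert.Δ := by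
  have h1 := (abs_le.mp (e.cert.lipschitz x (sys.f (x, e.cert.policy x, ω)))).1
  have h2 := mul_le_mul_of_nonneg_left (e.cert.bounded_step x ω) e.cert.L_pos.le
  linarith

theorem integrable_V_step (x : sys.X) :
    Integrable (fun ω => e.cert.V (sys.f (x, e.cert.policy x, ω))) sys.d := by
  have hm : Measurable fun ω => e.cert.V (sys.f (x, e.cert.policy x, ω)) :=
    e.cert.isRASM.continuous.measurable.comp (sys.continuous_f.measurable.comp
      (measurable_const.prodMk (measurable_const.prodMk measurable_id)))
  refine Integrable.of_bound hm.aestronglyMeasurable (e.cert.V x + e.cert.L * e.cert.Δ)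
    (.of_forall fun ω => ?_)
  rw [Real.norm_eq_abs, abs_of_nonneg (e.cert.isRASM.nonneg _)]
  exact e.V_step_le x ω

end LearnedEdge

/-- A bound for the expected number of steps needed to follow the edges `es`. -/
noncomputable def expectedSteps (es : List (LearnedEdge G)) : ℝ := (es.map LearnedEdge.slowness).sum

theorem expectedSteps_nonneg (es : List (LearnedEdge G)) : 0 ≤ expectedSteps es :=
  List.sum_nonneg fun a ha => by
    obtain ⟨e, _, rfl⟩ := List.mem_map.mp ha
    exact e.slowness_pos.le

theorem pathProb_mem_Icc {es : List (LearnedEdge G)} (h : ∀ e ∈ es, 0 ≤ e.prob) :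
    pathProb es ∈ Icc (0 : ℝ) 1 := by
  induction es with
  | nil => simp [pathProb]
  | cons e es ih =>
    have hes := ih fun e' he' => h e' (by simp [he'])
    have he : 0 ≤ e.prob := h e (by simp)
    have he1 : e.prob ≤ 1 := e.prob_le.trans (by linarith [e.risk_pos 0])
    rw [pathProb, List.map_cons, List.prod_cons]
    exact ⟨mul_nonneg he hes.1, mul_le_one₀ he1 hes.1 hes.2⟩

/-- The bound for the probability of not succeeding within `T` steps, as a function of the value `v`
of the supermartingale of the current edge `e`, followed for `k` steps already. The first two terms
bound the probability of a violation on `e` or on `es`. The others bound the probability that more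
than `T` steps are needed: with `c = 1 / T₀` for the time bound `T₀` at the start, they are the
expected number of remaining steps and the number of elapsed steps, both divided by `T₀`. -/
noncomputable def failBound (c : ℝ) (T : ℕ) (e : LearnedEdge G) (es : List (LearnedEdge G))
    (k : ℕ) (v : ℝ) : ℝ :=
  1 - (1 - e.risk k * v) * pathProb es + c * (e.slowness * v + expectedSteps es) + (1 - c * T)

/-- Markov property: at a state outside the target and below the safety level, the failure
probability is the average of the failure probabilities after one step. -/
theorem noise_not_succeeds_succ (T : ℕ) (e : LearnedEdge G) (es : List (LearnedEdge G)) (x : sys.X)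
    (hV : e.cert.V x < e.cert.lam) (hx : x ∉ G.region e.tgt) :
    noise sys {w | ¬ Succeeds (T + 1) (e :: es) x w} =
      ∫⁻ ω, noise sys {w | ¬ Succeeds T (e :: es) (sys.f (x, e.cert.policy x, ω)) w} ∂sys.d := by
  let A : Set (sys.W × (ℕ → sys.W)) :=
    {q | ¬ Succeeds T (e :: es) (sys.f (x, e.cert.policy x, q.1)) q.2}
  have hA : MeasurableSet A := by
    have hg : Measurable fun q : sys.W × (ℕ → sys.W) =>
        (sys.f (x, e.cert.policy x, q.1), q.2) :=
      (sys.continuous_f.measurable.comp (measurable_const.prodMk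
        (measurable_const.prodMk measurable_fst))).prodMk measurable_snd
    exact hg (measurableSet_succeeds T (e :: es)).compl
  have hset : {w | ¬ Succeeds (T + 1) (e :: es) x w} =
      (fun w : ℕ → sys.W => (w 0, fun t => w (t + 1))) ⁻¹' A := by
    ext w
    simp only [mem_ofPred_eq, mem_preimage, A, Succeeds, hV, hx, if_false, true_and]
  rw [hset, (measurePreserving_head_tail sys).measure_preimage hA.nullMeasurableSet,
    Measure.prod_apply hA]
  rfl

/-- The bound does not increase on average along a step from a state outside the target. The step
costs `c`, which the expected decrease of `c * e.slowness * V` makes up for. -/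
theorem lintegral_failBound_le {c : ℝ} (hc : 0 ≤ c) {T : ℕ} (hT : c * T ≤ 1) (e : LearnedEdge G)
    {es : List (LearnedEdge G)} (hes : ∀ e' ∈ es, 0 ≤ e'.prob) (k : ℕ) {x : sys.X}
    (hV : e.cert.V x ≤ e.cert.lam) (hx : x ∉ G.region e.tgt) :
    ∫⁻ ω, ENNReal.ofReal (failBound c T e es (k + 1)
        (e.cert.V (sys.f (x, e.cert.policy x, ω)))) ∂sys.d ≤
      ENNReal.ofReal (failBound c (T + 1) e es k (e.cert.V x)) := by
  obtain ⟨hQ0, hQ1⟩ := pathProb_mem_Icc hes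
  have hD := expectedSteps_nonneg es
  have ha := e.slowness_pos
  have hr := e.risk_pos (k + 1)
  let A : ℝ := 1 - pathProb es + c * expectedSteps es + (1 - c * T)
  let B : ℝ := e.risk (k + 1) * pathProb es + c * e.slowness
  have hB : 0 ≤ B := by positivity
  have hA : 0 ≤ A := by
    have := mul_nonneg hc hD
    simp only [A]
    linarith
  have haff : ∀ v, failBound c T e es (k + 1) v = A + B * v := fun v => by
    simp only [failBound, A, B]
    ring
  have hint := (e.integrable_V_step x).const_mul B
  simp only [haff]
  have hsum : Integrable (fun ω => A + B * e.cert.V (sys.f (x, e.cert.policy x, ω))) sys.d :=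
    (integrable_const A).add hint
  rw [← ofReal_integral_eq_lintegral_ofReal hsum
    (.of_forall fun ω => add_nonneg hA (mul_nonneg hB (e.cert.isRASM.nonneg _)))]
  refine ENNReal.ofReal_le_ofReal ?_
  rw [integral_add (integrable_const A) hint, integral_const_mul, integral_const]
  simp only [probReal_univ, one_smul]
  have hdec := mul_le_mul_of_nonneg_left (e.cert.isRASM.decrease x hx hV) hB
  have hγ : 0 < 1 - e.cert.γ := sub_pos.mpr e.cert.isRASM.gamma_lt_one
  have hδ := e.cert.isRASM.delta_pos
  have hstep : 1 ≤ e.slowness * (1 - e.cert.γ) * e.cert.V x := by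
    have h1 : e.slowness * (1 - e.cert.γ) * e.cert.δ = 1 := by
      unfold LearnedEdge.slowness
      field_simp
    exact h1.ge.trans (mul_le_mul_of_nonneg_left (e.cert.isRASM.positive x hx) (by positivity))
  have hcstep := mul_le_mul_of_nonneg_left hstep hc
  have hB' : B * (e.cert.γ * e.cert.V x) =
      e.risk k * pathProb es * e.cert.V x + c * e.slowness * e.cert.γ * e.cert.V x := by
    rw [← e.risk_succ_mul k]
    ring
  have hR : failBound c (T + 1) e es k (e.cert.V x) =
      A + e.risk k * pathProb es * e.cert.V x + c * e.slowness * e.cert.V x - c := by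
    simp only [failBound, A]
    push_cast
    ring
  rw [hR]
  nlinarith [hdec, hB', hcstep]

theorem succeeds_cons_of_mem {T : ℕ} {e : LearnedEdge G} {es : List (LearnedEdge G)} {x : sys.X}
    {w : ℕ → sys.W} (hV : e.cert.V x < e.cert.lam) (hx : x ∈ G.region e.tgt) :
    Succeeds T (e :: es) x w ↔ Succeeds T es x w := by
  cases T <;> simp [Succeeds, hV, hx]

/-- The bound holds at states where the safety level is exceeded or the target of the current edge
is reached. This leaves the states from which a step is made. -/
theorem noise_not_succeeds_cons_le {c : ℝ} (hc : 0 ≤ c) {T : ℕ} (hT : c * T ≤ 1)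
    {e : LearnedEdge G} {es : List (LearnedEdge G)} (hes : ∀ e' ∈ es, 0 ≤ e'.prob) {k : ℕ}
    {x : sys.X} (hk : e.cert.V x ≤ 1 + k * (e.cert.L * e.cert.Δ))
    (htgt : x ∈ G.region e.tgt → noise sys {w | ¬ Succeeds T es x w} ≤
      ENNReal.ofReal (1 - pathProb es + c * expectedSteps es + (1 - c * T)))
    (hstep : e.cert.V x < e.cert.lam → x ∉ G.region e.tgt →
      noise sys {w | ¬ Succeeds T (e :: es) x w} ≤
        ENNReal.ofReal (failBound c T e es k (e.cert.V x))) :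
    noise sys {w | ¬ Succeeds T (e :: es) x w} ≤
      ENNReal.ofReal (failBound c T e es k (e.cert.V x)) := by
  obtain ⟨hQ0, hQ1⟩ := pathProb_mem_Icc hes
  have hcD := mul_nonneg hc (expectedSteps_nonneg es)
  have hv := e.cert.isRASM.nonneg x
  have hcv := mul_nonneg hc (mul_nonneg e.slowness_pos.le hv)
  by_cases hV : e.cert.V x < e.cert.lam
  · by_cases hx : x ∈ G.region e.tgt
    · simp only [succeeds_cons_of_mem hV hx]
      refine (htgt hx).trans (ENNReal.ofReal_le_ofReal ?_)
      have := mul_nonneg (mul_nonneg (e.risk_pos k).le hv) hQ0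
      unfold failBound
      nlinarith
    · exact hstep hV hx
  · refine prob_le_one.trans (ENNReal.one_le_ofReal.mpr ?_)
    have := mul_nonneg (sub_nonneg.mpr (e.one_le_risk_mul hk (not_lt.mp hV))) hQ0
    unfold failBound
    nlinarith

theorem failBound_zero_le {c : ℝ} (hc : 0 ≤ c) (T : ℕ) (e : LearnedEdge G)
    {es : List (LearnedEdge G)} (hes : ∀ e' ∈ es, 0 ≤ e'.prob) {v : ℝ} (hv : v ≤ 1) :
    failBound c T e es 0 v ≤
      1 - pathProb (e :: es) + c * expectedSteps (e :: es) + (1 - c * T) := by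
  have h1 : e.prob * pathProb es ≤ (1 - e.risk 0 * v) * pathProb es := by
    refine mul_le_mul_of_nonneg_right (e.prob_le.trans ?_) (pathProb_mem_Icc hes).1
    have := mul_le_mul_of_nonneg_left hv (e.risk_pos 0).le
    linarith
  have h2 : c * (e.slowness * v + expectedSteps es) ≤ c * (e.slowness + expectedSteps es) := by
    refine mul_le_mul_of_nonneg_left ?_ hc
    have := mul_le_mul_of_nonneg_left hv e.slowness_pos.le
    linarith
  have h3 : pathProb (e :: es) = e.prob * pathProb es := by
    simp only [pathProb, List.map_cons, List.prod_cons]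
  have h4 : expectedSteps (e :: es) = e.slowness + expectedSteps es := by
    simp only [expectedSteps, List.map_cons, List.sum_cons]
  rw [h3, h4]
  unfold failBound
  linarith

/-- The bound for the failure probability from the start of a path follows from the bound along its
first edge. -/
theorem noise_not_succeeds_le_of_cons {c : ℝ} (hc : 0 ≤ c) {T : ℕ} {u v : G.V}
    {e : LearnedEdge G} {es : List (LearnedEdge G)} (hp : IsPath u v (e :: es))
    (hes : ∀ e' ∈ es, 0 ≤ e'.prob)
    (h : ∀ (k : ℕ) (x : sys.X), e.cert.V x ≤ 1 + k * (e.cert.L * e.cert.Δ) →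
      noise sys {w | ¬ Succeeds T (e :: es) x w} ≤
        ENNReal.ofReal (failBound c T e es k (e.cert.V x))) {x : sys.X} (hx : x ∈ G.region u) :
    noise sys {w | ¬ Succeeds T (e :: es) x w} ≤
      ENNReal.ofReal
        (1 - pathProb (e :: es) + c * expectedSteps (e :: es) + (1 - c * T)) := by
  have hV : e.cert.V x ≤ 1 := e.cert.isRASM.initial x (hp.1 ▸ hx)
  exact (h 0 x (by simpa using hV)).trans
    (ENNReal.ofReal_le_ofReal (failBound_zero_le hc T e hes hV))

/-- The bound for the failure probability, both from the start of a path and on the way along its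
first edge. -/
theorem noise_not_succeeds_le {c : ℝ} (hc : 0 ≤ c) (v : G.V) (T : ℕ) (hT : c * T ≤ 1)
    (es : List (LearnedEdge G)) :
    ∀ u : G.V, IsPath u v es → (∀ e ∈ es, 0 ≤ e.prob) →
      (∀ x ∈ G.region u, noise sys {w | ¬ Succeeds T es x w} ≤
        ENNReal.ofReal (1 - pathProb es + c * expectedSteps es + (1 - c * T))) ∧
      ∀ e es', es = e :: es' → ∀ (k : ℕ) (x : sys.X),
        e.cert.V x ≤ 1 + k * (e.cert.L * e.cert.Δ) →
        noise sys {w | ¬ Succeeds T (e :: es') x w} ≤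
          ENNReal.ofReal (failBound c T e es' k (e.cert.V x)) := by
  have hnil : ∀ (T : ℕ) (x : sys.X),
      noise sys {w | ¬ Succeeds (G := G) T [] x w} = 0 := fun T x => by
    simp [Succeeds]
  induction T generalizing es with
  | zero =>
    induction es with
    | nil =>
      refine fun u _ _ => ⟨fun x _ => ?_, fun e es' h => (by cases h)⟩
      rw [hnil]
      exact zero_le
    | cons e es ih =>
      intro u hp hes
      have hes' : ∀ e' ∈ es, 0 ≤ e'.prob := fun e' he' => hes e' (by simp [he'])
      have key : ∀ (k : ℕ) (x : sys.X), e.cert.V x ≤ 1 + k * (e.cert.L * e.cert.Δ) →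
          noise sys {w | ¬ Succeeds 0 (e :: es) x w} ≤
            ENNReal.ofReal (failBound c 0 e es k (e.cert.V x)) := by
        intro k x hk
        refine noise_not_succeeds_cons_le hc hT hes' hk ((ih e.tgt hp.2 hes').1 x) fun _ _ => ?_
        refine prob_le_one.trans (ENNReal.one_le_ofReal.mpr ?_)
        -- with no time left the term `1 - c * T` alone is a bound for the probability
        obtain ⟨hQ0, hQ1⟩ := pathProb_mem_Icc hes'
        have hv := e.cert.isRASM.nonneg x
        have h1 := mul_nonneg (mul_nonneg (e.risk_pos k).le hv) hQ0
        have h2 := mul_nonneg hc (mul_nonneg e.slowness_pos.le hv)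
        have h3 := mul_nonneg hc (expectedSteps_nonneg es)
        simp only [failBound, Nat.cast_zero]
        nlinarith
      refine ⟨fun x hx => noise_not_succeeds_le_of_cons hc hp hes' key hx, fun e' es' h => ?_⟩
      cases h
      exact key
  | succ T ihT =>
    have hT' : c * T ≤ 1 := by
      push_cast at hT
      linarith
    induction es with
    | nil =>
      refine fun u _ _ => ⟨fun x _ => ?_, fun e es' h => (by cases h)⟩
      rw [hnil]
      exact zero_le
    | cons e es ih =>
      intro u hp hes
      have hes' : ∀ e' ∈ es, 0 ≤ e'.prob := fun e' he' => hes e' (by simp [he'])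
      have key : ∀ (k : ℕ) (x : sys.X), e.cert.V x ≤ 1 + k * (e.cert.L * e.cert.Δ) →
          noise sys {w | ¬ Succeeds (T + 1) (e :: es) x w} ≤
            ENNReal.ofReal (failBound c (T + 1) e es k (e.cert.V x)) := by
        intro k x hk
        refine noise_not_succeeds_cons_le hc hT hes' hk ((ih e.tgt hp.2 hes').1 x) fun hV hx => ?_
        rw [noise_not_succeeds_succ T e es x hV hx]
        refine (lintegral_mono fun ω => ?_).trans
          (lintegral_failBound_le hc hT' e hes' k hV.le hx)
        refine (ihT hT' (e :: es) u hp hes).2 e es rfl (k + 1) _ ((e.V_step_le x ω).trans ?_)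
        push_cast
        linarith
      refine ⟨fun x hx => noise_not_succeeds_le_of_cons hc hp hes' key hx, fun e' es' h => ?_⟩
      cases h
      exact key

/-- From each state in the region where a path starts, success within `T` steps has probability at
least `pathProb es`, up to an error that vanishes as `T` grows. -/
theorem ofReal_pathProb_sub_le_noise_succeeds {u v : G.V} {es : List (LearnedEdge G)}
    (hp : IsPath u v es) (hes : ∀ e ∈ es, 0 ≤ e.prob) {x : sys.X} (hx : x ∈ G.region u) (T : ℕ) :
    ENNReal.ofReal (pathProb es - expectedSteps es / (T + 1)) ≤
      noise sys {w | Succeeds (T + 1) es x w} := by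
  have hT : (0 : ℝ) < T + 1 := by positivity
  -- the largest admissible coefficient `c` for the time bound `T + 1`
  have hc : (1 / (T + 1 : ℝ)) * ((T + 1 : ℕ) : ℝ) = 1 := by
    push_cast
    field_simp
  have h := (noise_not_succeeds_le (c := 1 / (T + 1 : ℝ)) (by positivity) v (T + 1) hc.le es u hp
    hes).1 x hx
  rw [hc] at h
  have hm : MeasurableSet {w | Succeeds (T + 1) es x w} :=
    measurable_prodMk_left (x := x) (measurableSet_succeeds (T + 1) es)
  have hcompl : {w | ¬ Succeeds (T + 1) es x w} = {w | Succeeds (T + 1) es x w}ᶜ := rfl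
  rw [hcompl, prob_compl_eq_one_sub hm] at h
  rw [tsub_le_iff_left] at h
  have h0 : 0 ≤ 1 - pathProb es + expectedSteps es / (T + 1) :=
    add_nonneg (sub_nonneg.mpr (pathProb_mem_Icc hes).2)
      (div_nonneg (expectedSteps_nonneg es) hT.le)
  have harg : 1 - pathProb es + 1 / (T + 1 : ℝ) * expectedSteps es + (1 - 1) =
      1 - pathProb es + expectedSteps es / (T + 1) := by ring
  rw [harg] at h
  have hsub : pathProb es - expectedSteps es / (T + 1 : ℝ) =
      1 - (1 - pathProb es + expectedSteps es / (T + 1)) := by ring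
  rw [hsub, ENNReal.ofReal_sub _ h0, ENNReal.ofReal_one, tsub_le_iff_right]
  exact h

end FailureBound

/-! ### Guarantees of composed policies -/

section Guarantee

variable {n m r : ℕ} {sys : ControlSystem n m r} {X₀ : Set sys.X} {G : AbstractGraph sys.X X₀}

theorem noise_succeeds_le_noise_sat {φ : SpectRL sys.X} (hG : IsAbstractGraphFor sys G φ)
    (e : LearnedEdge G) (es : List (LearnedEdge G)) (hp : IsPath G.source G.target (e :: es))
    {x₀ : sys.X} (hx₀ : x₀ ∈ X₀) (T : ℕ) :
    noise sys {w | Succeeds T (e :: es) x₀ w} ≤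
      noise sys {w | φ.Sat (states sys (composeEdges e es) x₀ w)} := by
  refine measure_mono_ae ?_
  filter_upwards [ae_mem_support sys] with w hw (hs : Succeeds T (e :: es) x₀ w)
  have hf : Follows (states sys (composeEdges e es) x₀ w) (e :: es) 0 :=
    follows_of_succeeds e es x₀ w T (e :: es) 0 0 x₀ rfl rfl (by simpa only [Nat.zero_add] using hs)
  refine hG (fun t => (states sys (composeEdges e es) x₀ w t,
    (composeEdges e es).act (run sys (composeEdges e es) x₀ w t).2
      (states sys (composeEdges e es) x₀ w t), w t)) (fun t => ⟨hw t, rfl⟩) hx₀ ?_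
  exact hf.reachability hp hx₀

theorem guarantees_composeEdges {φ : SpectRL sys.X} (hG : IsAbstractGraphFor sys G φ)
    (e : LearnedEdge G) (es : List (LearnedEdge G)) (hp : IsPath G.source G.target (e :: es))
    (hes : ∀ e' ∈ e :: es, 0 ≤ e'.prob) {p : ℝ} (hpQ : p ≤ pathProb (e :: es)) :
    Guarantees sys X₀ (composeEdges e es) φ p := by
  intro x₀ hx₀
  refine ⟨measurable_states_composeEdges e es x₀ φ.measurableSet_sat, ?_⟩
  have hlim : Filter.Tendsto
      (fun T : ℕ => ENNReal.ofReal (pathProb (e :: es) - expectedSteps (e :: es) / (T + 1)))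
      Filter.atTop (nhds (ENNReal.ofReal (pathProb (e :: es)))) := by
    refine ENNReal.tendsto_ofReal ?_
    have h := (tendsto_one_div_add_atTop_nhds_zero_nat (𝕜 := ℝ)).const_mul
      (expectedSteps (e :: es))
    simpa [div_eq_mul_inv] using h.const_sub (pathProb (e :: es))
  refine (ENNReal.ofReal_le_ofReal hpQ).trans (le_of_tendsto' hlim fun T => ?_)
  exact (ofReal_pathProb_sub_le_noise_succeeds hp hes (by rwa [G.region_source]) T).trans
    (noise_succeeds_le_noise_sat hG e es hp hx₀ (T + 1))

end Guarantee

/-! ### The forward pass -/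

section Pass

variable {n m r : ℕ} {sys : ControlSystem n m r} {X₀ : Set sys.X} {G : AbstractGraph sys.X X₀}
  {learn : PolicyRASM G} {prec : ℕ} {p : ℝ} {order : List G.V}

theorem binarySearch_spec {τ : ReachAvoidTask sys.X}
    {query : (q : ℝ) → Option (EdgeCertificate sys τ q)} {k : ℕ} {lo hi : ℝ}
    {best : Option (Σ q : ℝ, EdgeCertificate sys τ q)} (hlo : 0 ≤ lo) (hhi : 0 ≤ hi)
    (hbest : ∀ c, best = some c → query c.1 = some c.2 ∧ 0 ≤ c.1)
    {c : Σ q : ℝ, EdgeCertificate sys τ q} (hc : binarySearch query k lo hi best = some c) :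
    query c.1 = some c.2 ∧ 0 ≤ c.1 := by
  induction k generalizing lo hi best with
  | zero => exact hbest c hc
  | succ k ih =>
    have hmid : 0 ≤ (lo + hi) / 2 := by linarith
    rw [binarySearch] at hc
    split at hc
    next c' hq =>
      refine ih hmid hhi (fun c'' h => ?_) hc
      cases h
      exact ⟨hq, hmid⟩
    next hq => exact ih hlo hmid hbest hc

/-- All edge policies recorded in the table were returned by `learn`, for nonnegative parameters. -/
def PassState.Sound (learn : PolicyRASM G) (st : PassState G) : Prop :=
  ∀ u v c, st.learned u v = some c → learn u v c.1 = some c.2 ∧ 0 ≤ c.1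

theorem processEdge_learned_of_ne {v : G.V} {st : PassState G} {u u' v' : G.V}
    (h : u' ≠ u ∨ v' ≠ v) :
    (processEdge G learn prec v st u).learned u' v' = st.learned u' v' := by
  unfold processEdge
  split
  · rfl
  · by_cases hu : u' = u
    · subst hu
      simp only [Function.update_self]
      rw [Function.update_of_ne (h.resolve_left (not_not.mpr rfl))]
    · simp only [Function.update_of_ne hu]

theorem processEdge_prob_of_ne {v : G.V} {st : PassState G} {u v' : G.V} (h : v' ≠ v) :
    (processEdge G learn prec v st u).prob v' = st.prob v' := by
  unfold processEdge
  split
  · rfl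
  · exact Function.update_of_ne h _ _

theorem processEdge_prob_self (v : G.V) (st : PassState G) (u : G.V) :
    (processEdge G learn prec v st u).prob v = st.prob v ∨
      ∃ c, (processEdge G learn prec v st u).learned u v = some c ∧
        (processEdge G learn prec v st u).prob v = c.1 * st.prob u := by
  unfold processEdge
  split
  · exact .inl rfl
  next c _ =>
    rcases le_total (c.1 * st.prob u) (st.prob v) with h | h
    · left
      simp only [Function.update_self, max_eq_left h]
    · right
      exact ⟨c, by simp only [Function.update_self],
        by simp only [Function.update_self, max_eq_right h]⟩

theorem processEdge_sound {v : G.V} {st : PassState G} (hst : st.Sound learn) (u : G.V) :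
    (processEdge G learn prec v st u).Sound learn := by
  intro u' v' c hc
  by_cases h : u' ≠ u ∨ v' ≠ v
  · rw [processEdge_learned_of_ne h] at hc
    exact hst _ _ _ hc
  · push Not at h
    obtain ⟨rfl, rfl⟩ := h
    unfold processEdge at hc
    split at hc
    · exact hst _ _ _ hc
    next c' hq =>
      simp only [Function.update_self] at hc
      cases hc
      exact binarySearch_spec le_rfl zero_le_one (fun _ h => (by cases h)) hq

/-- Processing the edges from `us` to `v`. Distinctness of the vertices in `us` ensures that no
learned policy is overwritten. -/
theorem foldl_processEdge_spec {v : G.V} {us : List G.V} (hnd : us.Nodup) (hv : v ∉ us)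
    (st : PassState G) :
    (∀ v' ≠ v, (us.foldl (processEdge G learn prec v) st).prob v' = st.prob v') ∧
    (∀ u' v', (u' ∉ us ∨ v' ≠ v) →
      (us.foldl (processEdge G learn prec v) st).learned u' v' = st.learned u' v') ∧
    ((us.foldl (processEdge G learn prec v) st).prob v = st.prob v ∨
      ∃ u ∈ us, ∃ c, (us.foldl (processEdge G learn prec v) st).learned u v = some c ∧
        (us.foldl (processEdge G learn prec v) st).prob v = c.1 * st.prob u) := by
  induction us generalizing st with
  | nil => exact ⟨fun _ _ => rfl, fun _ _ _ => rfl, .inl rfl⟩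
  | cons u us ih =>
    obtain ⟨hu, hnd'⟩ := List.nodup_cons.mp hnd
    rw [List.mem_cons, not_or] at hv
    obtain ⟨h1, h2, h3⟩ := ih hnd' hv.2 (processEdge G learn prec v st u)
    rw [List.foldl_cons]
    refine ⟨fun v' hv' => (h1 v' hv').trans (processEdge_prob_of_ne hv'),
      fun u' v' h => ?_, ?_⟩
    · rw [List.mem_cons, not_or] at h
      exact (h2 u' v' (h.imp_left And.right)).trans
        (processEdge_learned_of_ne (h.imp_left And.left))
    · rcases h3 with h3 | ⟨u', hu', c, hc, hp⟩
      · rcases processEdge_prob_self (learn := learn) (prec := prec) v st u with h | ⟨c, hc, hp⟩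
        · exact .inl (h3.trans h)
        · exact .inr ⟨u, by simp, c, (h2 u v (.inl hu)).trans hc, h3.trans hp⟩
      · refine .inr ⟨u', by simp [hu'], c, hc, ?_⟩
        rw [hp, processEdge_prob_of_ne]
        rintro rfl
        exact hv.2 hu'

theorem ne_of_edge {u v : G.V} (h : G.Edge u v) : u ≠ v := by
  rintro rfl
  exact G.acyclic u (.single h)

theorem processVertex_spec (hnd : order.Nodup) (st : PassState G) (v : G.V) :
    (∀ v' ≠ v, (processVertex G learn prec p order st v).prob v' = st.prob v') ∧
    (∀ u' v', v' ≠ v →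
      (processVertex G learn prec p order st v).learned u' v' = st.learned u' v') ∧
    ((processVertex G learn prec p order st v).prob v = 0 ∨
      ∃ u, G.Edge u v ∧ p ≤ st.prob u ∧
        ∃ c, (processVertex G learn prec p order st v).learned u v = some c ∧
          (processVertex G learn prec p order st v).prob v = c.1 * st.prob u) := by
  have hmem : ∀ u, u ∈ order.filter (fun u => G.Edge u v ∧ p ≤ st.prob u) →
      G.Edge u v ∧ p ≤ st.prob u := fun u hu => by
    simpa using (List.mem_filter.mp hu).2
  obtain ⟨h1, h2, h3⟩ := foldl_processEdge_spec (learn := learn) (prec := prec) (v := v)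
    (us := order.filter (fun u => G.Edge u v ∧ p ≤ st.prob u)) (hnd.filter _)
    (fun hv => ne_of_edge (hmem v hv).1 rfl) { st with prob := Function.update st.prob v 0 }
  refine ⟨fun v' hv' => (h1 v' hv').trans (Function.update_of_ne hv' _ _),
    fun u' v' hv' => h2 u' v' (.inr hv'), ?_⟩
  rcases h3 with h3 | ⟨u, hu, c, hc, hp⟩
  · exact .inl (h3.trans (by simp only [Function.update_self]))
  · refine .inr ⟨u, (hmem u hu).1, (hmem u hu).2, c, hc, hp.trans ?_⟩
    simp only [Function.update_of_ne (ne_of_edge (hmem u hu).1)]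

theorem foldl_processVertex_of_notMem (hnd : order.Nodup) {vs : List G.V} {v : G.V} (hv : v ∉ vs)
    (st : PassState G) :
    (vs.foldl (processVertex G learn prec p order) st).prob v = st.prob v ∧
      ∀ u, (vs.foldl (processVertex G learn prec p order) st).learned u v = st.learned u v := by
  induction vs generalizing st with
  | nil => exact ⟨rfl, fun _ => rfl⟩
  | cons v' vs ih =>
    rw [List.mem_cons, not_or] at hv
    obtain ⟨h1, h2⟩ := ih hv.2 (processVertex G learn prec p order st v')
    obtain ⟨h3, h4, _⟩ := processVertex_spec (learn := learn) (prec := prec) (p := p) hnd st v'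
    exact ⟨h1.trans (h3 v hv.1), fun u => (h2 u).trans (h4 u v hv.1)⟩

theorem forwardPass_sound : (forwardPass G learn prec p order).Sound learn := by
  unfold forwardPass
  refine List.foldlRecOn (motive := PassState.Sound learn) _ _ (fun u v c h => nomatch h) ?_
  intro st hst v _
  unfold processVertex
  exact List.foldlRecOn (motive := PassState.Sound learn) _ _ hst
    fun st' hst' u _ => processEdge_sound hst' u

variable (learn prec p) in
theorem forwardPass_prob_source (ho : IsTopologicalOrder G order) :
    (forwardPass G learn prec p order).prob G.source = 1 := by
  have hnd := ho.nodup
  obtain ⟨tl, rfl⟩ := List.head?_eq_some_iff.mp ho.head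
  unfold forwardPass
  rw [List.tail_cons]
  rw [(foldl_processVertex_of_notMem hnd (List.nodup_cons.mp hnd).1 _).1]
  simp only [if_true]

/-- A positive entry of the table, other than that of the source, is attained by a learned edge. The
entries and the policies are the final ones: in a topological order the predecessors of a vertex
are treated before it, and entries of vertices treated before are not modified. -/
theorem exists_learned_of_prob_pos (ho : IsTopologicalOrder G order) {v : G.V} (hv : v ≠ G.source)
    (hpos : 0 < (forwardPass G learn prec p order).prob v) :
    ∃ u, G.Edge u v ∧ p ≤ (forwardPass G learn prec p order).prob u ∧
      ∃ c, (forwardPass G learn prec p order).learned u v = some c ∧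
        (forwardPass G learn prec p order).prob v =
          c.1 * (forwardPass G learn prec p order).prob u := by
  have hnd := ho.nodup
  obtain ⟨tl, htl⟩ := List.head?_eq_some_iff.mp ho.head
  have hvtl : v ∈ tl := by
    have := ho.mem v
    rw [htl, List.mem_cons] at this
    exact this.resolve_left hv
  obtain ⟨pre, post, hpp⟩ := List.append_of_mem hvtl
  have hsub : (v :: post).Sublist order := by
    rw [htl, hpp]
    exact (List.sublist_append_right pre _).cons _
  have hvpost : v ∉ post := (List.nodup_cons.mp (hnd.sublist hsub)).1
  have hafter : ∀ u ∈ post, ¬ G.Edge u v := (List.pairwise_cons.mp (ho.forward.sublist hsub)).1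
  set st := pre.foldl (processVertex G learn prec p order)
    { prob := fun v => if v = G.source then 1 else 0, learned := fun _ _ => none } with hst
  have hfin : forwardPass G learn prec p order = post.foldl (processVertex G learn prec p order)
      (processVertex G learn prec p order st v) := by
    unfold forwardPass
    rw [hst]
    conv_lhs => rw [show order.tail = pre ++ v :: post by rw [htl, List.tail_cons, hpp]]
    rw [List.foldl_append, List.foldl_cons]
  obtain ⟨h1, h2, h3⟩ := processVertex_spec (learn := learn) (prec := prec) (p := p) hnd st v
  obtain ⟨h4, h5⟩ := foldl_processVertex_of_notMem (learn := learn) (prec := prec) (p := p) hnd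
    hvpost (processVertex G learn prec p order st v)
  rw [← hfin] at h4 h5
  rcases h3 with h3 | ⟨u, hE, hpu, c, hc, hpv⟩
  · rw [h4, h3] at hpos
    exact absurd hpos (lt_irrefl 0)
  · have hu : (forwardPass G learn prec p order).prob u = st.prob u := by
      rw [hfin, (foldl_processVertex_of_notMem hnd (fun h => hafter u h hE) _).1,
        h1 u (ne_of_edge hE)]
    exact ⟨u, hE, hu ▸ hpu, c, (h5 u).trans hc, by rw [h4, hpv, hu]⟩

/-- The conditions under which the algorithm may use an edge in the output path. -/
def IsUsable (learn : PolicyRASM G) (prec : ℕ) (p : ℝ) (order : List G.V)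
    (e : LearnedEdge G) : Prop :=
  p ≤ (forwardPass G learn prec p order).prob e.src ∧
    (forwardPass G learn prec p order).learned e.src e.tgt = some ⟨e.prob, e.cert⟩ ∧
    (forwardPass G learn prec p order).prob e.tgt =
      e.prob * (forwardPass G learn prec p order).prob e.src

theorem IsPath.append_singleton {u : G.V} {es : List (LearnedEdge G)} {e : LearnedEdge G}
    (h : IsPath u e.src es) : IsPath u e.tgt (es ++ [e]) := by
  induction es generalizing u with
  | nil => exact ⟨Eq.symm h, rfl⟩
  | cons e' es ih => exact ⟨h.1, ih h.2⟩

theorem exists_path_of_prob_ge (ho : IsTopologicalOrder G order) (hp : 0 < p) (v : G.V)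
    (hv : p ≤ (forwardPass G learn prec p order).prob v) :
    ∃ es : List (LearnedEdge G), IsPath G.source v es ∧
      ∀ e ∈ es, IsUsable learn prec p order e := by
  have hfin := G.finite
  have hirr : Std.Irrefl (Relation.TransGen G.Edge) := ⟨G.acyclic⟩
  have hwf := Finite.wellFounded_of_trans_of_irrefl (Relation.TransGen G.Edge)
  induction v using hwf.induction with
  | _ v ih =>
    by_cases hs : v = G.source
    · exact ⟨[], hs.symm, by simp⟩
    · obtain ⟨u, hE, hu, c, hc, hpv⟩ := exists_learned_of_prob_pos ho hs (hp.trans_le hv)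
      obtain ⟨es, hes, hall⟩ := ih u (.single hE) hu
      refine ⟨es ++ [⟨u, v, hE, c.1, c.2⟩], IsPath.append_singleton (e := ⟨u, v, hE, c.1, c.2⟩) hes,
        fun e he => ?_⟩
      rcases List.mem_append.mp he with he | he
      · exact hall e he
      · rw [List.mem_singleton] at he
        subst he
        exact ⟨hu, hc, hpv⟩

theorem prob_eq_pathProb_mul {u v : G.V} {es : List (LearnedEdge G)} (h : IsPath u v es)
    (hes : ∀ e ∈ es, IsUsable learn prec p order e) :
    (forwardPass G learn prec p order).prob v =
      pathProb es * (forwardPass G learn prec p order).prob u := by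
  induction es generalizing u with
  | nil =>
    cases h
    simp [pathProb]
  | cons e es ih =>
    obtain ⟨rfl, h⟩ := h
    rw [ih h fun e' he' => hes e' (by simp [he']), (hes e (by simp)).2.2]
    simp only [pathProb, List.map_cons, List.prod_cons]
    ring

end Pass

end Claps

theorem mainTheorem3 {n m r : ℕ} (sys : Claps.ControlSystem n m r)
    (X₀ : Set sys.X) (hX₀ : MeasurableSet X₀)
    (φ : Claps.SpectRL sys.X) (p : ℝ) (hp : p ∈ Set.Icc (0 : ℝ) 1) :
    Claps.IsAbstractGraphFor sys (φ.abstractGraph X₀ hX₀) φ ∧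
    ∀ G : Claps.AbstractGraph sys.X X₀, Claps.IsAbstractGraphFor sys G φ →
      ∀ (order : List G.V), Claps.IsTopologicalOrder G order →
      ∀ (learn : Claps.PolicyRASM G) (prec : ℕ),
        (∀ π : Claps.Policy sys.X sys.U, Claps.Outputs G learn prec p order π →
          Claps.Guarantees sys X₀ π φ p ∧ Claps.IsCompositional G learn φ p π) ∧
        (0 < p → G.source ≠ G.target →
          p ≤ (Claps.forwardPass G learn prec p order).prob G.target →
          ∃ π : Claps.Policy sys.X sys.U, Claps.Outputs G learn prec p order π) := by
  refine ⟨fun ρ _ _ h => φ.sat_of_reachability h, fun G hG order ho learn prec => ⟨?_, ?_⟩⟩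
  · rintro π ⟨ht, e, es, hpath, hes, rfl⟩
    have hsound : ∀ e' ∈ e :: es, learn e'.src e'.tgt e'.prob = some e'.cert ∧ 0 ≤ e'.prob :=
      fun e' he' => Claps.forwardPass_sound _ _ _ (hes e' he').2.1
    have hprob := Claps.prob_eq_pathProb_mul hpath hes
    rw [Claps.forwardPass_prob_source learn prec p ho, mul_one] at hprob
    have hg : Claps.Guarantees sys X₀ (Claps.composeEdges e es) φ p :=
      Claps.guarantees_composeEdges hG e es hpath (fun e' he' => (hsound e' he').2)
        (ht.trans_eq hprob)
    exact ⟨hg, hg, e, es, hpath, fun e' he' => (hsound e' he').1, rfl⟩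
  · intro hp0 hst ht
    obtain ⟨es, hpath, hes⟩ := Claps.exists_path_of_prob_ge ho hp0 G.target ht
    cases es with
    | nil => exact absurd hpath hst
    | cons e es => exact ⟨_, ht, e, es, hpath, hes, rfl⟩
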